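/- Let $\mathbb{K}$ be an algebraically closed field of characteristic zero, $M$ a lattice, $\mathcal{A}\subset M$ a finite subset, and $\tau\subseteq\mathcal{A}$ a face of $\mathcal{A}$, i.e. the intersection of $\mathcal{A}$ with a face of $\operatorname{conv}\mathcal{A}$. For natural numbers $\ell,d$ put $\Delta_\ell(d)=\{v\in\mathbb{Z}_{\ge 0}^{\ell+1} : v_0+\dots+v_\ell=d\}$. A *degree $d$ Cayley structure* of length $\ell$ on $\tau$ is a non-constant affine-linear map $\pi:\tau\to\Delta_\ell(d)$ (i.e. a map preserving integral affine relations) such that for every $i\in\{0,\dots,\ell\}$ there are $u,w\in\tau$ with $\pi(u)_i=0$ and $\pi(w)_i\neq 0$. For a set $S$ of lattice points let $\langle S\rangle$ be the sublattice generated by the differences of elements of $S$, and $\dim S$ its rank. The Cayley structure $\pi$ is *imprimitive* if either $\dim\pi(\tau)=1$ and $\ell>1$, or $\ell=1$ and $\langle\pi(\tau)\rangle\subseteq m\mathbb{Z}^2$ for some integer $m>1$; otherwise it is *primitive*. If $\pi$ is imprimitive with image $\mathcal{B}$, let $d'$ be the lattice length of $\operatorname{conv}\mathcal{B}$ with respect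 to the rank-one lattice $\langle\mathcal{B}\rangle$; a *reduction* $\mathrm{Red}(\pi)$ of $\pi$ is a composition $\tau\to\mathcal{B}\to\Delta_1(d')$ of $\pi$ with an injective affine-linear map $\mathcal{B}\to\Delta_1(d')$ (unique up to exchanging the two coordinates); its degree is $d'$. For a tuple $\mathbf{f}=(f_0,\dots,f_\ell)$ of linear forms in $\mathbb{K}[y_0,y_1]$ let $C_{\pi,\mathbf{f}}\subset\mathbb{P}^{\#\mathcal{A}-1}$ be the Zariski closure of the image of the rational map $\mathbb{P}^1\dashrightarrow\mathbb{P}^{\#\mathcal{A}-1}$ whose coordinate indexed by $u\in\mathcal{A}$ is $\prod_{i=0}^{\ell} f_i^{\pi(u)_i}$ if $u\in\tau$ and $0$ if $u\notin\tau$. The degree of a curve in projective space is the number of its intersection points with a general hyperplane. "For general $\mathbf{f}$" means: for all $\mathbf{f}$ in some nonempty Zariski-open subset of $(\mathbb{K}^2)^{\ell+1}$. **Theorem.** Let $\pi:\tau\to\Delta_\ell(d)$ be a degree $d$ Cayley structure. 1. One has $\deg C_{\pi,\mathbf{f}}=d$ for general $\mathbf{f}$ if and only if $\pi$ is primitive.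 2. If $\pi$ is imprimitive, then a reduction exists, and for every reduction $\mathrm{Red}(\pi)$, of degree $d'$, and every tuple $\mathbf{f}$ of $\ell+1$ nonzero linear forms with pairwise distinct roots one has $C_{\pi,\mathbf{f}}=C_{\mathrm{Red}(\pi)}$ and $\deg C_{\pi,\mathbf{f}}=d'$. Here $C_{\mathrm{Red}(\pi)}$ denotes $C_{\mathrm{Red}(\pi),\mathbf{g}}$ for any pair $\mathbf{g}=(g_0,g_1)$ of nonzero linear forms with distinct roots (the equality holds for every such $\mathbf{g}$). -/

import Mathlib

/-! ### Lattice points, faces, affine-linear maps -/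

/-- `⟨S⟩`: the sublattice generated by all differences of elements of `S`. -/
def diffLattice {N : Type*} [AddCommGroup N] (S : Set N) : Submodule ℤ N :=
  Submodule.span ℤ {x | ∃ a ∈ S, ∃ b ∈ S, x = a - b}

/-- The dimension of (the affine hull of) a set of lattice points. -/
noncomputable def latticeDim {N : Type*} [AddCommGroup N] (S : Set N) : ℕ :=
  Module.finrank ℤ (diffLattice S)

/-- `τ` is the intersection of `A` with a (nonempty) face of the polytope `conv A ⊂ M ⊗ ℝ`:
the set of points of `A` at which some real linear functional on `M ⊗ ℝ` (that is, an additive map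
`M → ℝ`) attains its minimum. The zero functional gives `A` itself. -/
def IsFace {M : Type*} [AddCommGroup M] (A : Finset M) (τ : Set M) : Prop :=
  ∃ φ : M →+ ℝ, τ = {u | u ∈ A ∧ ∀ w ∈ A, φ u ≤ φ w}

/-- A map from a set of lattice points to an abelian group is affine-linear if it preserves all
integral affine relations. -/
def IsAffineLinear {N N' : Type*} [AddCommGroup N] [AddCommGroup N'] (S : Set N) (g : S → N') :
    Prop :=
  ∀ a : S →₀ ℤ, (a.sum fun _ c => c) = 0 → (a.sum fun u c => c • (u : N)) = 0 →
    (a.sum fun u c => c • g u) = 0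

/-! ### Cayley structures -/

/-- `Δ_ℓ(d)`: tuples `(v_0, …, v_ℓ)` of nonnegative integers with sum `d`. -/
abbrev CayleySimplex (ℓ d : ℕ) : Type := {v : Fin (ℓ + 1) → ℕ // ∑ i, v i = d}

/-- A point of `Δ_ℓ(d)` as an element of the lattice `ℤ^{ℓ+1}`. -/
def CayleySimplex.toLattice {ℓ d : ℕ} (v : CayleySimplex ℓ d) : Fin (ℓ + 1) → ℤ :=
  fun i => (v.1 i : ℤ)

section Cayley

variable {M : Type*} {τ : Set M} {ℓ d : ℕ}

/-- The image of `π : τ → Δ_ℓ(d)` as a set of lattice points. -/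
def imageSet (π : τ → CayleySimplex ℓ d) : Set (Fin (ℓ + 1) → ℤ) :=
  Set.range fun u => (π u).toLattice

/-- A weak Cayley structure of length `ℓ` and degree `d` on `τ`: a non-constant affine-linear map
`τ → Δ_ℓ(d)`. -/
structure IsWeakCayleyStructure [AddCommGroup M] (π : τ → CayleySimplex ℓ d) : Prop where
  nonconstant : ∃ u w, π u ≠ π w
  affine : IsAffineLinear τ fun u => (π u).toLattice

/-- No index `i` is a basepoint, i.e. satisfies `π(u)_i > 0` for all `u`. -/
def IsBasepointFree (π : τ → CayleySimplex ℓ d) : Prop :=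
  ¬ ∃ i, ∀ u, 0 < (π u).1 i

/-- Every coordinate is nonzero somewhere on the image. -/
def IsConcise (π : τ → CayleySimplex ℓ d) : Prop :=
  ∀ i, ∃ u, (π u).1 i ≠ 0

/-- A Cayley structure is a weak Cayley structure that is basepoint-free and concise. -/
structure IsCayleyStructure [AddCommGroup M] (π : τ → CayleySimplex ℓ d) : Prop
    extends IsWeakCayleyStructure π where
  basepointFree : IsBasepointFree π
  concise : IsConcise π

/-- `π` is imprimitive if either `dim π(τ) = 1` and `ℓ > 1`, or `ℓ = 1` and
`⟨π(τ)⟩ ⊆ m ℤ^2` for some `m > 1`. -/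
def IsImprimitive (π : τ → CayleySimplex ℓ d) : Prop :=
  (latticeDim (imageSet π) = 1 ∧ 1 < ℓ) ∨
    (ℓ = 1 ∧ ∃ m : ℕ, 1 < m ∧ ∀ x ∈ diffLattice (imageSet π), ∀ i, (m : ℤ) ∣ x i)

/-- `π` is primitive if it is not imprimitive. -/
def IsPrimitive (π : τ → CayleySimplex ℓ d) : Prop := ¬ IsImprimitive π

/-- `k` is the lattice length of `conv S` with respect to the one-dimensional lattice `⟨S⟩`:
for a generator `w` of `⟨S⟩`, it is the largest `k` such that two points of `S` differ
by `k • w`. -/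
def IsLatticeLength {N : Type*} [AddCommGroup N] (S : Set N) (k : ℕ) : Prop :=
  ∃ w : N, w ≠ 0 ∧ diffLattice S = Submodule.span ℤ {w} ∧
    IsGreatest {j : ℕ | ∃ a ∈ S, ∃ b ∈ S, a - b = j • w} k

/-- `π' : τ → Δ_1(d')` is a reduction of the imprimitive Cayley structure `π`: `d'` is the lattice
length of `conv π(τ)` with respect to `⟨π(τ)⟩`, and `π'` is the composition of `π : τ → π(τ)` with
an injective affine-linear map `ψ : π(τ) → Δ_1(d')`. (It is unique up to transposing the two
coordinates.) -/
def IsReduction (π : τ → CayleySimplex ℓ d) {d' : ℕ} (π' : τ → CayleySimplex 1 d') : Prop :=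
  IsLatticeLength (imageSet π) d' ∧
    ∃ ψ : imageSet π → CayleySimplex 1 d', Function.Injective ψ ∧
      IsAffineLinear (imageSet π) (fun b => (ψ b).toLattice) ∧
      ∀ u, π' u = ψ ⟨(π u).toLattice, Set.mem_range_self u⟩

end Cayley

/-! ### Projective geometry -/

/-- A property holds for a general point of the affine space `K^σ` if it holds on a nonempty
Zariski-open subset (equivalently, on a nonempty basic open subset). -/
def ForGeneral {K σ : Type*} [Field K] (p : (σ → K) → Prop) : Prop :=
  ∃ P : MvPolynomial σ K, P ≠ 0 ∧ ∀ x : σ → K, MvPolynomial.eval x P ≠ 0 → p x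

/-- The Zariski closure of a subset of projective space: the common zeros of all homogeneous
polynomials that vanish on the subset. -/
def zariskiClosure {K σ : Type*} [Field K] (S : Set (Projectivization K (σ → K))) :
    Set (Projectivization K (σ → K)) :=
  {p | ∀ (n : ℕ) (F : MvPolynomial σ K), F.IsHomogeneous n →
    (∀ q ∈ S, MvPolynomial.eval q.rep F = 0) → MvPolynomial.eval p.rep F = 0}

/-- The degree of a (reduced) curve `C` in projective space is `k`: a general hyperplane
`∑ s, a s * x s = 0` meets `C` in exactly `k` points. -/
def HasDegree {K σ : Type*} [Field K] [Fintype σ] (C : Set (Projectivization K (σ → K)))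
    (k : ℕ) : Prop :=
  ForGeneral fun a : σ → K => {p ∈ C | ∑ s, a s * p.rep s = 0}.encard = (k : ℕ∞)

/-! ### The curve of a Cayley structure -/

section Curve

variable {K : Type*} [Field K]

/-- The value at `y` of the linear form `g 0 * y_0 + g 1 * y_1`. -/
def linForm (g : Fin 2 → K) (y : Fin 2 → K) : K := g 0 * y 0 + g 1 * y 1

/-- The linear forms `f_0, …, f_ℓ` are nonzero with pairwise distinct roots in `ℙ^1`. -/
def HasDistinctRoots {ℓ : ℕ} (f : Fin (ℓ + 1) → Fin 2 → K) : Prop :=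
  (∀ i, f i ≠ 0) ∧
    ∀ i j, i ≠ j → ∀ y : Fin 2 → K, y ≠ 0 → linForm (f i) y = 0 → linForm (f j) y ≠ 0

variable {M : Type*} {τ : Set M} {ℓ d : ℕ}

open Classical in
/-- The vector `(f^{π(u)}(y))_{u ∈ A}`, with entry `0` for `u ∉ τ`. -/
noncomputable def rhoVec (A : Finset M) (π : τ → CayleySimplex ℓ d)
    (f : Fin (ℓ + 1) → Fin 2 → K) (y : Fin 2 → K) : A → K :=
  fun u => if h : (u : M) ∈ τ then ∏ i, linForm (f i) y ^ (π ⟨u, h⟩).1 i else 0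

/-- The image of the rational map `ρ_{π,f} : ℙ^1 ⇢ ℙ^{#A-1}`. -/
def rhoImage (A : Finset M) (π : τ → CayleySimplex ℓ d) (f : Fin (ℓ + 1) → Fin 2 → K) :
    Set (Projectivization K (A → K)) :=
  {p | ∃ y : Fin 2 → K, y ≠ 0 ∧ ∃ h : rhoVec A π f y ≠ 0, p = Projectivization.mk K _ h}

/-- `C_{π,f}`: the closure of the image of `ρ_{π,f}`. -/
def cayleyCurve (A : Finset M) (π : τ → CayleySimplex ℓ d) (f : Fin (ℓ + 1) → Fin 2 → K) :
    Set (Projectivization K (A → K)) :=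
  zariskiClosure (rhoImage A π f)

end Curve

/-! The curve is the image of a map ρ from ℙ¹ given by forms of degree `d`. When the linear forms
have distinct roots, at most one vanishes at a given point, so basepoint-freeness makes ρ a morphism
with closed image, and a hyperplane pulls back to a binary form of degree `d`. If ρ is injective up
to finitely many points, Bertini gives `d` simple zeros for a general hyperplane, with distinct
images, so the degree is `d` (`hasDegree_of_parametrization`). The rest depends on the rank of
⟨π(τ)⟩.

Rank at least two; π is then primitive. Suppose that ρ identifies a generic point `t` with some
other `t'`, for generic coefficients of the forms. Taking logarithmic derivatives of the resulting
monomial identities with respect to each coefficient forces all differences of values of π to be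
proportional (`proportional_of_derivations`), a contradiction. Elimination turns this generic
statement into one on a Zariski-open set (`MvPolynomial.exists_rename_inl_mem`); characteristic zero
enters because the partial derivatives must extend to a field containing `t'`.

Rank one. Let `w` generate the lattice, with lattice coordinate `k` and lattice length `N`.
Basepoint-freeness and conciseness force π(u) = (N - k(u)) w⁻ + k(u) w⁺. Hence ρ is the surjection
(f^{w⁻} : f^{w⁺}) of ℙ¹ followed by the monomial map with exponents `(N - k, k)`, which is also the
parametrization of the reduction up to a change of coordinates. The values of `k` have no common
divisor, so the monomial map is generically injective and the degree is `N`. Since d = N ∑ w⁺ and no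
`w i` vanishes, `N = d` exactly when ℓ = 1 and w = ±(1, -1), which is primitivity
(`IsLinearCoordinate.isPrimitive_iff`). -/

/-! ### Extending derivations and elimination -/

/-- A derivation extends along a formally smooth algebra. -/
theorem Derivation.exists_extension_of_formallySmooth {R L : Type*} [CommRing R] [CommRing L]
    [Algebra R L] [Algebra.FormallySmooth R L] (D : R →+ L)
    (hD : ∀ a b, D (a * b) = algebraMap R L a * D b + algebraMap R L b * D a) :
    ∃ D' : Derivation ℤ L L, ∀ r, D' (algebraMap R L r) = D r := by
  have hD1 : D 1 = 0 := by simpa using hD 1 1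
  -- A derivation is the ε-part of a ring homomorphism `r ↦ r + ε D r` to the dual numbers. Formal
  -- smoothness lifts the identity of `L` through the square-zero projection from the dual numbers,
  -- and the ε-part of the lift is the extension.
  let φ : R →+* TrivSqZeroExt L L :=
    { toFun := fun r => TrivSqZeroExt.inl (algebraMap R L r) + TrivSqZeroExt.inr (D r)
      map_one' := by ext <;> simp [hD1]
      map_mul' := by
        intro a b
        ext
        · simp
        · simp [hD, mul_comm (D a)]
      map_zero' := by ext <;> simp
      map_add' := by
        intro a b
        ext <;> simp }
  have hφ : ∀ r, φ r = TrivSqZeroExt.inl (algebraMap R L r) + TrivSqZeroExt.inr (D r) :=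
    fun r => rfl
  let alg : Algebra R (TrivSqZeroExt L L) := φ.toAlgebra
  let g : TrivSqZeroExt L L →ₐ[R] L :=
    { (TrivSqZeroExt.fstHom L L L).toRingHom with
      commutes' := by
        intro r
        change (φ r).fst = _
        rw [hφ]
        simp }
  have hgapp : ∀ x, g x = x.fst := fun x => rfl
  have hg : Function.Surjective g := fun x => ⟨TrivSqZeroExt.inl x, by simp [hgapp]⟩
  have hker : IsNilpotent (RingHom.ker (g : TrivSqZeroExt L L →+* L)) := by
    refine ⟨2, ?_⟩
    exact TrivSqZeroExt.kerIdeal_sq L L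
  let Θ := Algebra.FormallySmooth.liftOfSurjective (AlgHom.id R L) g hg hker
  have hΘ1 : ∀ x, (Θ x).fst = x := fun x =>
    Algebra.FormallySmooth.liftOfSurjective_apply (AlgHom.id R L) g hg hker x
  have hΘ2 : ∀ r, Θ (algebraMap R L r) = φ r := fun r => Θ.commutes r
  refine ⟨Derivation.mk' (AddMonoidHom.toIntLinearMap
    { toFun := fun x => (Θ x).snd
      map_zero' := by simp
      map_add' := by intro a b; simp }) ?_, ?_⟩
  · intro a b
    simp only [AddMonoidHom.coe_toIntLinearMap, AddMonoidHom.coe_mk, ZeroHom.coe_mk, map_mul,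
      TrivSqZeroExt.snd_mul, hΘ1, smul_eq_mul, MulOpposite.smul_eq_mul_unop, MulOpposite.unop_op]
    ring
  · intro r
    change (Θ (algebraMap R L r)).snd = _
    rw [hΘ2, hφ]
    simp

universe u v w

/-- A prime ideal of a finitely generated algebra over a field is the kernel of a homomorphism to
an essentially finitely generated field extension. -/
theorem Ideal.IsPrime.exists_algHom_field {K : Type u} {B : Type v} [Field K] [CommRing B] [Algebra K B]
    [Algebra.FiniteType K B] {Q : Ideal B} (hQ : Q.IsPrime) :
    ∃ (L : Type v) (_ : Field L) (_ : Algebra K L) (_ : Algebra.EssFiniteType K L)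
      (ψ : B →ₐ[K] L), ∀ p, ψ p = 0 ↔ p ∈ Q := by
  refine ⟨FractionRing (B ⧸ Q), inferInstance, inferInstance,
    inferInstanceAs (Algebra.EssFiniteType K (Localization (nonZeroDivisors (B ⧸ Q)))),
    (IsScalarTower.toAlgHom K (B ⧸ Q) _).comp (Ideal.Quotient.mkₐ K Q), fun p => ?_⟩
  change algebraMap (B ⧸ Q) (FractionRing (B ⧸ Q)) (Ideal.Quotient.mk Q p) = 0 ↔ _
  rw [FaithfulSMul.algebraMap_eq_zero_iff, Ideal.Quotient.eq_zero_iff_mem]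

/-- A field extension in characteristic zero is formally smooth over any subalgebra over which it
is essentially of finite type. -/
theorem Algebra.FormallySmooth.of_faithfulSMul_essFiniteType {K R L : Type*} [Field K]
    [CharZero K] [CommRing R] [IsDomain R] [Algebra K R] [Field L] [Algebra K L] [Algebra R L]
    [IsScalarTower K R L] [FaithfulSMul R L] [Algebra.EssFiniteType K L] :
    Algebra.FormallySmooth R L := by
  let algF : Algebra (FractionRing R) L := FractionRing.liftAlgebra _ _
  have : IsScalarTower R (FractionRing R) L := FractionRing.isScalarTower_liftAlgebra _ _
  have : IsScalarTower K (FractionRing R) L := IsScalarTower.to₁₃₄ K R _ _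
  have : Algebra.EssFiniteType (FractionRing R) L := Algebra.EssFiniteType.of_comp K _ _
  have : CharZero (FractionRing R) := charZero_of_injective_algebraMap
    (algebraMap K (FractionRing R)).injective
  have : Algebra.FormallySmooth R (FractionRing R) :=
    Algebra.FormallySmooth.of_isLocalization (nonZeroDivisors R)
  exact Algebra.FormallySmooth.comp _ (FractionRing R) _

/-- Elimination in characteristic zero: an ideal `I` in the variables `σ ⊕ ι` contains a nonzero
polynomial in the variables `σ` alone, unless `I` has a zero in some field on which all the partial
derivatives with respect to the `σ`-coordinates are defined. -/
theorem MvPolynomial.exists_rename_inl_mem {K : Type u} {σ : Type v} {ι : Type w} [Field K] [CharZero K]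
    [Finite σ] [Finite ι] (I : Ideal (MvPolynomial (σ ⊕ ι) K))
    (h : ∀ (L : Type (max u v w)) [Field L] [Algebra K L] (x : σ → L) (y : ι → L),
      (∀ s, ∃ D : Derivation K L L, D (x s) = 1 ∧ ∀ s', s' ≠ s → D (x s') = 0) →
      (∀ p ∈ I, aeval (Sum.elim x y) p = 0) → False) :
    ∃ P : MvPolynomial σ K, P ≠ 0 ∧ rename Sum.inl P ∈ I := by
  classical
  by_contra hcon
  push Not at hcon
  -- If `I` contains no nonzero polynomial in the σ-variables, some prime above `I` does not either.
  -- In its residue field the σ-coordinates are algebraically independent, so the partial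
  -- derivatives exist on the polynomial ring they generate and extend.
  obtain ⟨Q, hQ, hIQ, hdisj⟩ := Ideal.exists_le_prime_disjoint I
    ((nonZeroDivisors (MvPolynomial σ K)).map (rename (R := K) (Sum.inl : σ → σ ⊕ ι))) (by
      rw [Set.disjoint_left]
      rintro _ hp ⟨P, hP, rfl⟩
      exact hcon P (nonZeroDivisors.ne_zero hP) hp)
  obtain ⟨L, _, _, _, ψ, hψ⟩ := hQ.exists_algHom_field (K := K)
  let x : σ → L := fun s => ψ (X (Sum.inl s))
  let y : ι → L := fun s => ψ (X (Sum.inr s))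
  have hψe : ψ = aeval (Sum.elim x y) := by
    ext i
    rcases i with i | i <;> simp [x, y]
  let algR : Algebra (MvPolynomial σ K) L := (ψ.toRingHom.comp
    (rename (R := K) (Sum.inl : σ → σ ⊕ ι)).toRingHom).toAlgebra
  have halg : ∀ p, algebraMap (MvPolynomial σ K) L p = ψ (rename Sum.inl p) := fun p => rfl
  have tower : IsScalarTower K (MvPolynomial σ K) L := IsScalarTower.of_algebraMap_eq' (by
    ext k
    simp [halg])
  have : FaithfulSMul (MvPolynomial σ K) L := by
    rw [faithfulSMul_iff_algebraMap_injective, injective_iff_map_eq_zero]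
    intro p hp
    by_contra hne
    rw [halg, hψ] at hp
    exact Set.disjoint_left.mp hdisj hp ⟨p, mem_nonZeroDivisors_of_ne_zero hne, rfl⟩
  have : Algebra.FormallySmooth (MvPolynomial σ K) L :=
    Algebra.FormallySmooth.of_faithfulSMul_essFiniteType (K := K)
  refine h L x y ?_ ?_
  · intro s
    obtain ⟨D', hD'⟩ := Derivation.exists_extension_of_formallySmooth (L := L)
      (MvPolynomial.mkDerivation K (A := L) (Pi.single s (1 : L)) :
        MvPolynomial σ K →ₗ[K] L).toAddMonoidHom (fun a b => by
          simp [Algebra.smul_def])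
    have hD'' : ∀ r, D' (algebraMap (MvPolynomial σ K) L r) =
      MvPolynomial.mkDerivation K (A := L) (Pi.single s (1 : L)) r := hD'
    have hx : ∀ s, x s = algebraMap (MvPolynomial σ K) L (X s) := fun s => by simp [halg, x]
    have hDK : ∀ k : K, D' (algebraMap K L k) = 0 := fun k => by
      rw [IsScalarTower.algebraMap_apply K (MvPolynomial σ K) L, hD'', MvPolynomial.algebraMap_eq,
        MvPolynomial.derivation_C]
    refine ⟨Derivation.mk' { (D' : L →ₗ[ℤ] L) with
      map_smul' := fun k z => by simp [Algebra.smul_def, hDK] } fun a b => D'.leibniz a b, ?_,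
      fun s' hs' => ?_⟩
    · change D' _ = _
      rw [hx, hD'', MvPolynomial.mkDerivation_X]
      simp
    · change D' _ = _
      rw [hx, hD'', MvPolynomial.mkDerivation_X]
      simp [hs']
  · intro p hp
    rw [← hψe]
    exact (hψ p).2 (hIQ hp)

/-! ### Images of base-point-free maps are closed -/

namespace MvPolynomial

variable {K : Type*} [Field K] {σ ι : Type*}

theorem homogeneousComponent_mul_of_isHomogeneous {F : MvPolynomial ι K} {d n : ℕ}
    (hF : F.IsHomogeneous d) (g : MvPolynomial ι K) (hdn : d ≤ n) :
    homogeneousComponent n (g * F) = homogeneousComponent (n - d) g * F := by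
  have key : ∀ k, homogeneousComponent n (homogeneousComponent k g * F) =
      if k = n - d then homogeneousComponent k g * F else 0 := by
    intro k
    rw [homogeneousComponent_of_mem ((homogeneousComponent_isHomogeneous k g).mul hF)]
    congr 1
    apply propext
    omega
  conv_lhs => rw [← sum_homogeneousComponent g]
  rw [Finset.sum_mul, map_sum]
  simp_rw [key]
  rw [Finset.sum_ite_eq']
  split_ifs with h
  · rfl
  · have h' : g.totalDegree < n - d := by
      rw [Finset.mem_range] at h
      omega
    rw [homogeneousComponent_eq_zero _ _ h', zero_mul]

theorem aeval_homogeneousComponent {F : σ → MvPolynomial ι K} {d : ℕ} (hd : d ≠ 0)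
    (hF : ∀ s, (F s).IsHomogeneous d) (G : MvPolynomial σ K) (n : ℕ) :
    aeval F (homogeneousComponent n G) = homogeneousComponent (d * n) (aeval F G) := by
  have key : ∀ k, homogeneousComponent (d * n) (aeval F (homogeneousComponent k G)) =
      if k = n then aeval F (homogeneousComponent k G) else 0 := by
    intro k
    rw [homogeneousComponent_of_mem ((homogeneousComponent_isHomogeneous k G).aeval F hF)]
    congr 1
    apply propext
    exact ⟨fun h => (Nat.eq_of_mul_eq_mul_left (Nat.pos_of_ne_zero hd) h).symm,
      fun h => by rw [h]⟩
  conv_rhs => rw [← sum_homogeneousComponent G]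
  rw [map_sum, map_sum]
  simp_rw [key]
  rw [Finset.sum_ite_eq']
  split_ifs with h
  · rfl
  · rw [homogeneousComponent_eq_zero _ _ (by simpa [Nat.lt_succ_iff] using h), map_zero]

theorem IsHomogeneous.eval_smul {G : MvPolynomial σ K} {n : ℕ} (hG : G.IsHomogeneous n)
    (c : K) (x : σ → K) : eval (c • x) G = c ^ n * eval x G := by
  rw [eval_eq, eval_eq, Finset.mul_sum]
  refine Finset.sum_congr rfl fun m hm => ?_
  have h : ∑ i ∈ m.support, m i = n := (hG.degree_eq_sum_deg_support hm).symm
  simp only [Pi.smul_apply, smul_eq_mul, mul_pow, Finset.prod_mul_distrib]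
  rw [Finset.prod_pow_eq_pow_sum, h]
  ring

variable [IsAlgClosed K] [Finite ι] [Finite σ]

/-- Homogeneous polynomials without common zero in projective space generate a subalgebra over
which the polynomial ring is integral. -/
theorem aeval_isIntegral_of_isHomogeneous {F : σ → MvPolynomial ι K} {d : ℕ} (hd : d ≠ 0)
    (hF : ∀ s, (F s).IsHomogeneous d) (hne : ∀ y : ι → K, y ≠ 0 → ∃ s, eval y (F s) ≠ 0) :
    (aeval F : MvPolynomial σ K →ₐ[K] MvPolynomial ι K).toRingHom.IsIntegral := by
  classical
  have := Fintype.ofFinite σ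
  have := Fintype.ofFinite ι
  have hrad : ∀ i, ∃ N, (X i : MvPolynomial ι K) ^ N ∈ Ideal.span (Set.range F) := by
    intro i
    have : (X i : MvPolynomial ι K) ∈ (Ideal.span (Set.range F)).radical := by
      rw [← vanishingIdeal_zeroLocus_eq_radical (K := K), mem_vanishingIdeal_iff]
      intro y hy
      by_cases h0 : y = 0
      · simp [h0]
      obtain ⟨s, hs⟩ := hne y h0
      exact absurd (by simpa using hy (F s) (Ideal.subset_span ⟨s, rfl⟩)) hs
    exact this
  choose N₀ hN₀ using hrad
  -- One exponent serving all variables; the summand `d` makes the truncated subtraction `N - d` the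
  -- true degree of the coefficients.
  let N := (∑ i, N₀ i) + d
  have hN : ∀ i, ∃ c : σ → MvPolynomial ι K, (∀ s, (c s).IsHomogeneous (N - d)) ∧
      ∑ s, c s * F s = X i ^ N := by
    intro i
    have hle : N₀ i ≤ N :=
      (Finset.single_le_sum (fun _ _ => Nat.zero_le _) (Finset.mem_univ i)).trans
        (Nat.le_add_right _ _)
    have hmem := Ideal.pow_mem_of_pow_mem _ (hN₀ i) hle
    obtain ⟨c, hc⟩ := Ideal.mem_span_range_iff_exists_fun.mp hmem
    refine ⟨fun s => homogeneousComponent (N - d) (c s),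
      fun s => homogeneousComponent_isHomogeneous _ _, ?_⟩
    have := congrArg (homogeneousComponent N) hc
    rw [map_sum, homogeneousComponent_eq_self (isHomogeneous_X_pow i N)] at this
    rw [← this]
    refine Finset.sum_congr rfl fun s _ => ?_
    rw [homogeneousComponent_mul_of_isHomogeneous (hF s) _ (Nat.le_add_left _ _)]
  let _ : Algebra (MvPolynomial σ K) (MvPolynomial ι K) :=
    (aeval F : MvPolynomial σ K →ₐ[K] MvPolynomial ι K).toRingHom.toAlgebra
  have hsmul : ∀ (a : MvPolynomial σ K) (b : MvPolynomial ι K), a • b = aeval F a * b :=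
    fun a b => rfl
  -- Monomials with all exponents below `N` generate the ring as a module: any other monomial
  -- contains some `X i ^ N`, which is rewritten through the `F s` with coefficients of lower
  -- degree.
  let gen : (ι → Fin N) → MvPolynomial ι K := fun m =>
    monomial (Finsupp.equivFunOnFinite.symm fun i => (m i : ℕ)) 1
  let W : Submodule (MvPolynomial σ K) (MvPolynomial ι K) := Submodule.span _ (Set.range gen)
  have hW : ∀ n, ∀ p : MvPolynomial ι K, p.IsHomogeneous n → p ∈ W := by
    intro n
    induction n using Nat.strong_induction_on with
    | _ n ih =>
      intro p hp
      rw [p.as_sum]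
      refine Submodule.sum_mem _ fun m hm => ?_
      have hdeg : m.degree = n := by
        by_contra hcon
        exact (mem_support_iff.mp hm) (hp.coeff_eq_zero hcon)
      have hC : monomial m (coeff m p) =
          (C (coeff m p) : MvPolynomial σ K) • (monomial m 1 : MvPolynomial ι K) := by
        rw [hsmul]
        simp [C_mul_monomial, algebraMap_eq]
      rw [hC]
      refine Submodule.smul_mem _ _ ?_
      by_cases hlt : ∀ i, m i < N
      · refine Submodule.subset_span ⟨fun i => ⟨m i, hlt i⟩, ?_⟩
        simp only [gen]
        rw [show (Finsupp.equivFunOnFinite.symm fun i => m i) = m from by ext; simp]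
      push Not at hlt
      obtain ⟨i, hi⟩ := hlt
      obtain ⟨c, hc, hsum⟩ := hN i
      have hle : Finsupp.single i N ≤ m := by simpa using hi
      have hm' : (monomial m 1 : MvPolynomial ι K) =
          ∑ s, (X s : MvPolynomial σ K) • (c s * monomial (m - Finsupp.single i N) 1) := by
        have : (monomial m 1 : MvPolynomial ι K) =
            X i ^ N * monomial (m - Finsupp.single i N) 1 := by
          rw [X_pow_eq_monomial, monomial_mul, add_tsub_cancel_of_le hle, one_mul]
        rw [this, ← hsum, Finset.sum_mul]
        refine Finset.sum_congr rfl fun s _ => ?_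
        rw [hsmul, aeval_X]
        ring
      rw [hm']
      refine Submodule.sum_mem _ fun s _ => Submodule.smul_mem _ _ ?_
      have hdeg' : (m - Finsupp.single i N).degree + N = n := by
        have := congrArg Finsupp.degree (tsub_add_cancel_of_le hle)
        rw [map_add, Finsupp.degree_single] at this
        omega
      -- The new degree is `n - d`, strictly smaller because `d ≠ 0`.
      refine ih ((N - d) + (m - Finsupp.single i N).degree) ?_ _
        ((hc s).mul (isHomogeneous_monomial _ rfl))
      have : d ≤ N := Nat.le_add_left _ _
      omega
  have hfin : Module.Finite (MvPolynomial σ K) (MvPolynomial ι K) := by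
    refine ⟨⟨(Set.finite_range gen).toFinset, ?_⟩⟩
    rw [Set.Finite.coe_toFinset, eq_top_iff]
    intro p _
    rw [← sum_homogeneousComponent p]
    exact Submodule.sum_mem _ fun n _ => hW n _ (homogeneousComponent_isHomogeneous _ _)
  have : Algebra.IsIntegral (MvPolynomial σ K) (MvPolynomial ι K) := inferInstance
  exact fun x => this.isIntegral x

end MvPolynomial

open MvPolynomial in
/-- The image of a base-point-free morphism between projective spaces, given by homogeneous
polynomials of positive degree, is Zariski closed. -/
theorem zariskiClosure_range_eq {K σ ι : Type*} [Field K] [IsAlgClosed K] [Finite ι] [Finite σ]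
    {F : σ → MvPolynomial ι K} {d : ℕ} (hd : d ≠ 0)
    (hF : ∀ s, (F s).IsHomogeneous d) (hne : ∀ y : ι → K, y ≠ 0 → ∃ s, eval y (F s) ≠ 0)
    (S : Set (Projectivization K (σ → K)))
    (hS : S = {p | ∃ y : ι → K, y ≠ 0 ∧ ∃ h : (fun s => eval y (F s)) ≠ 0,
      p = Projectivization.mk K _ h}) :
    zariskiClosure S = S := by
  refine Set.Subset.antisymm ?_ fun p hp n G hG h => h p hp
  intro p hp
  have hvan : ∀ q ∈ S, ∃ (c : K) (y : ι → K), q.rep = c • fun s => eval y (F s) := by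
    rw [hS]
    rintro _ ⟨y, -, h, rfl⟩
    obtain ⟨a, ha⟩ := Projectivization.exists_smul_eq_mk_rep K _ h
    exact ⟨(a : K), y, ha.symm⟩
  -- The closure only tests homogeneous polynomials, but the relations among the `F s` form a
  -- homogeneous ideal, since all the `F s` have the same positive degree.
  have hker : ∀ G, aeval F G = 0 → eval p.rep G = 0 := by
    intro G hG
    rw [← sum_homogeneousComponent G, map_sum]
    refine Finset.sum_eq_zero fun n _ => ?_
    refine hp n _ (homogeneousComponent_isHomogeneous n G) fun q hq => ?_
    obtain ⟨c, y, hcy⟩ := hvan q hq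
    rw [hcy, (homogeneousComponent_isHomogeneous n G).eval_smul]
    have h0 : eval y (aeval F (homogeneousComponent n G)) = 0 := by
      rw [aeval_homogeneousComponent hd hF, hG, map_zero, map_zero]
    have h1 : eval y (aeval F (homogeneousComponent n G)) =
        eval (fun s => eval y (F s)) (homogeneousComponent n G) := by
      simpa [aeval_eq_eval] using
        comp_aeval_apply (f := F) (aeval y : MvPolynomial ι K →ₐ[K] K) (homogeneousComponent n G)
    rw [← h1, h0, mul_zero]
  have hint := aeval_isIntegral_of_isHomogeneous hd hF hne
  let _ : Algebra (MvPolynomial σ K) (MvPolynomial ι K) :=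
    (aeval F : MvPolynomial σ K →ₐ[K] MvPolynomial ι K).toRingHom.toAlgebra
  have hmapeq : ∀ G, algebraMap (MvPolynomial σ K) (MvPolynomial ι K) G = aeval F G :=
    fun G => rfl
  have : Algebra.IsIntegral (MvPolynomial σ K) (MvPolynomial ι K) := ⟨hint⟩
  let P : Ideal (MvPolynomial σ K) := vanishingIdeal K {p.rep}
  have hP : P.IsMaximal := isMaximal_iff_eq_vanishingIdeal_singleton.mpr ⟨_, rfl⟩
  -- Lying over: the maximal ideal of `p.rep` contains the kernel of `aeval F`, so it is the
  -- contraction of a maximal ideal, which is a point `y` mapping to `p.rep` by the Nullstellensatz.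
  obtain ⟨Q, hQ, hQP⟩ := Ideal.exists_ideal_over_maximal_of_isIntegral
    (S := MvPolynomial ι K) P (by
      intro G hG
      rw [mem_vanishingIdeal_singleton_iff, aeval_eq_eval]
      exact hker G hG)
  obtain ⟨y, hy⟩ := isMaximal_iff_eq_vanishingIdeal_singleton.mp hQ
  have hval : (fun s => eval y (F s)) = p.rep := by
    funext s
    have h1 : (X s - C (p.rep s) : MvPolynomial σ K) ∈ P := by
      rw [mem_vanishingIdeal_singleton_iff]
      simp
    rw [← hQP, Ideal.mem_comap, hy, mem_vanishingIdeal_singleton_iff, hmapeq] at h1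
    simpa [sub_eq_zero, algebraMap_eq] using h1
  have hne0 : (fun s => eval y (F s)) ≠ 0 := hval ▸ p.rep_nonzero
  rw [hS]
  refine ⟨y, ?_, hne0, ?_⟩
  · rintro rfl
    apply hne0
    funext s
    have := (hF s).eval_smul (0 : K) 0
    rw [zero_pow hd, zero_mul, smul_zero] at this
    simpa using this
  · rw [← Projectivization.mk_rep p]
    simp only [Projectivization.mk_eq_mk_iff]
    exact ⟨1, by rw [one_smul, hval]⟩

/-! ### General points -/

section ForGeneral

variable {K σ : Type*} [Field K] {p q : (σ → K) → Prop}

theorem ForGeneral.mono (hp : ForGeneral p) (h : ∀ x, p x → q x) : ForGeneral q := by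
  obtain ⟨P, hP, hx⟩ := hp
  exact ⟨P, hP, fun x hne => h x (hx x hne)⟩

theorem ForGeneral.and (hp : ForGeneral p) (hq : ForGeneral q) :
    ForGeneral fun x => p x ∧ q x := by
  obtain ⟨P, hP, hx⟩ := hp
  obtain ⟨Q, hQ, hy⟩ := hq
  refine ⟨P * Q, mul_ne_zero hP hQ, fun x hne => ?_⟩
  rw [map_mul] at hne
  exact ⟨hx x (left_ne_zero_of_mul hne), hy x (right_ne_zero_of_mul hne)⟩

theorem ForGeneral.of_finite {ι : Type*} {s : Set ι} (hs : s.Finite) {p : ι → (σ → K) → Prop}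
    (h : ∀ i ∈ s, ForGeneral (p i)) : ForGeneral fun x => ∀ i ∈ s, p i x := by
  induction s, hs using Set.Finite.induction_on with
  | empty => exact ⟨1, one_ne_zero, fun x _ i hi => hi.elim⟩
  | insert _ _ ih =>
    refine ((h _ (Set.mem_insert _ _)).and (ih fun i hi => h i (Set.mem_insert_of_mem _ hi))).mono ?_
    rintro x ⟨h1, h2⟩ i (rfl | hi)
    · exact h1
    · exact h2 i hi

theorem ForGeneral.exists [Infinite K] (hp : ForGeneral p) : ∃ x, p x := by
  obtain ⟨P, hP, hx⟩ := hp
  by_contra hcon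
  push Not at hcon
  refine hP (MvPolynomial.funext fun x => ?_)
  rw [map_zero]
  by_contra hne
  exact hcon x (hx x hne)

theorem ForGeneral.linear_ne_zero [Fintype σ] {v : σ → K} (hv : v ≠ 0) :
    ForGeneral fun a : σ → K => ∑ s, a s * v s ≠ 0 := by
  classical
  obtain ⟨s, hs⟩ := Function.ne_iff.mp hv
  refine ⟨∑ s, MvPolynomial.X s * MvPolynomial.C (v s), fun h => hs ?_, fun x hx => ?_⟩
  · have := congrArg (MvPolynomial.eval (Pi.single s (1 : K))) h
    simpa [Pi.single_apply] using this
  · simpa using hx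

end ForGeneral

/-! ### Degrees of parametrized rational curves -/

open Polynomial in
/-- Polynomials without common root over an algebraically closed field have no common root in any
extension. -/
theorem Polynomial.exists_aeval_ne_zero_of_forall_exists_eval_ne_zero {K σ L : Type*} [Field K]
    [IsAlgClosed K] [Field L] [Algebra K L] {F : σ → K[X]} (hF : ∀ t, ∃ u, (F u).eval t ≠ 0)
    (t : L) : ∃ u, aeval t (F u) ≠ 0 := by
  by_contra hcon
  push Not at hcon
  -- The generator of this principal ideal has no root, hence is a unit; the resulting expression of
  -- 1 by the `F u` persists in `L`.
  let I := Ideal.span (Set.range F)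
  have hgen : I = Ideal.span {Submodule.IsPrincipal.generator I} :=
    (Ideal.span_singleton_generator I).symm
  set g := Submodule.IsPrincipal.generator I
  have hdvd : ∀ u, g ∣ F u := fun u => by
    rw [← Ideal.mem_span_singleton, ← hgen]
    exact Ideal.subset_span ⟨u, rfl⟩
  have hunit : IsUnit g := by
    rw [Polynomial.isUnit_iff_degree_eq_zero]
    by_contra hdeg
    obtain ⟨x, hx⟩ := IsAlgClosed.exists_root g hdeg
    obtain ⟨u, hu⟩ := hF x
    exact hu (hx.dvd (hdvd u))
  have hker : I ≤ RingHom.ker (aeval t : K[X] →ₐ[K] L) := by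
    rw [Ideal.span_le]
    rintro _ ⟨u, rfl⟩
    exact hcon u
  have htop : I = ⊤ := by rw [hgen, Ideal.span_singleton_eq_top.mpr hunit]
  have h1 : (1 : K[X]) ∈ RingHom.ker (aeval t : K[X] →ₐ[K] L) := hker (htop ▸ Submodule.mem_top)
  rw [RingHom.mem_ker, map_one] at h1
  exact one_ne_zero h1

open Polynomial in
/-- Bertini: a general member of a base-point-free linear system of polynomials has only simple
roots. -/
theorem forGeneral_forall_not_multiple_root {K σ : Type*} [Field K] [IsAlgClosed K] [CharZero K]
    [Fintype σ] {F : σ → K[X]} (hF : ∀ t, ∃ u, (F u).eval t ≠ 0) :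
    ForGeneral fun a : σ → K => ∀ t, ∑ u, a u * (F u).eval t = 0 →
      ∑ u, a u * (derivative (F u)).eval t ≠ 0 := by
  let G : (σ → K[X]) → MvPolynomial (σ ⊕ Unit) K := fun F =>
    ∑ u, MvPolynomial.X (Sum.inl u) * aeval (MvPolynomial.X (Sum.inr ())) (F u)
  have hG : ∀ {L : Type _} [Field L] [Algebra K L] (x : σ → L) (y : Unit → L) (F : σ → K[X]),
      MvPolynomial.aeval (Sum.elim x y) (G F) = ∑ u, x u * aeval (y ()) (F u) := by
    intro L _ _ x y F
    simp [G, ← Polynomial.aeval_algHom_apply]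
  obtain ⟨P, hP, hmem⟩ := MvPolynomial.exists_rename_inl_mem
    (Ideal.span {G F, G fun u => derivative (F u)}) (by
      intro L _ _ x y hD hzero
      have h1 := hzero _ (Ideal.subset_span (Set.mem_insert _ _))
      have h2 := hzero _ (Ideal.subset_span (Set.mem_insert_of_mem _ rfl))
      rw [hG] at h1 h2
      obtain ⟨s, hs⟩ := exists_aeval_ne_zero_of_forall_exists_eval_ne_zero hF (y ())
      obtain ⟨D, hDs, hDs'⟩ := hD s
      apply hs
      -- With `D` the derivative in the coefficient `x s`, this reads `F_s(t) + (∑ x_u F_u'(t)) D t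
      -- = 0`. The bracket vanishes at a multiple root, so `F_s(t) = 0`, against the choice of `s`.
      have h3 := congrArg D h1
      rw [map_zero, map_sum] at h3
      simp only [Derivation.leibniz, Derivation.map_aeval, smul_eq_mul, Finset.sum_add_distrib,
        ← mul_assoc] at h3
      rw [← Finset.sum_mul, h2, zero_mul, zero_add, Finset.sum_eq_single s] at h3
      · simpa [hDs] using h3
      · intro s' _ hne
        rw [hDs' s' hne, mul_zero]
      · simp)
  refine ⟨P, hP, fun a ha t h1 h2 => ha ?_⟩
  have hle : Ideal.span {G F, G fun u => derivative (F u)} ≤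
      RingHom.ker (MvPolynomial.aeval (Sum.elim a fun _ => t) :
        MvPolynomial (σ ⊕ Unit) K →ₐ[K] K) := by
    rw [Ideal.span_le]
    rintro p (rfl | rfl)
    · simpa only [SetLike.mem_coe, RingHom.mem_ker, G, map_sum, map_mul, MvPolynomial.aeval_X,
        ← Polynomial.aeval_algHom_apply, Sum.elim_inl, Sum.elim_inr,
        Polynomial.coe_aeval_eq_eval] using h1
    · simpa only [SetLike.mem_coe, RingHom.mem_ker, G, map_sum, map_mul, MvPolynomial.aeval_X,
        ← Polynomial.aeval_algHom_apply, Sum.elim_inl, Sum.elim_inr,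
        Polynomial.coe_aeval_eq_eval] using h2
  have := hle hmem
  rwa [RingHom.mem_ker, MvPolynomial.aeval_rename, Sum.elim_comp_inl,
    MvPolynomial.aeval_eq_eval] at this

theorem Projectivization.sum_mul_rep_eq_zero_iff {K σ : Type*} [Field K] [Fintype σ] (a : σ → K)
    {v : σ → K} (hv : v ≠ 0) :
    ∑ s, a s * (Projectivization.mk K v hv).rep s = 0 ↔ ∑ s, a s * v s = 0 := by
  obtain ⟨c, hc⟩ := Projectivization.exists_smul_eq_mk_rep K v hv
  have : ∑ s, a s * (Projectivization.mk K v hv).rep s = (c : K) * ∑ s, a s * v s := by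
    rw [← hc, Finset.mul_sum]
    refine Finset.sum_congr rfl fun s _ => ?_
    simp only [Pi.smul_apply, Units.smul_def, smul_eq_mul]
    ring
  rw [this, mul_eq_zero, or_iff_right c.ne_zero]

open Polynomial in
/-- A curve with a generically injective polynomial parametrization of degree `d` without base
points has degree `d`. -/
theorem hasDegree_of_parametrization {K σ : Type*} [Field K] [IsAlgClosed K] [CharZero K]
    [Fintype σ] {F : σ → K[X]} {d : ℕ} (hdeg : ∀ u, (F u).natDegree ≤ d)
    (hinf : (fun u => (F u).coeff d) ≠ 0) (hF : ∀ t, (fun u => (F u).eval t) ≠ 0)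
    (hfin : {t | ∃ t', t' ≠ t ∧ ∃ c : K, ∀ u, (F u).eval t' = c * (F u).eval t}.Finite) :
    HasDegree (insert (Projectivization.mk K _ hinf)
      (Set.range fun t => Projectivization.mk K _ (hF t))) d := by
  have hF' : ∀ t, ∃ u, (F u).eval t ≠ 0 := fun t => Function.ne_iff.mp (hF t)
  refine (((forGeneral_forall_not_multiple_root hF').and (.linear_ne_zero hinf)).and
    (.of_finite hfin fun t _ => .linear_ne_zero (hF t))).mono ?_
  rintro a ⟨⟨hsimple, hlead⟩, hbad⟩
  -- The pullback of the hyperplane. It has degree exactly `d` because the hyperplane misses the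
  -- image of infinity, its roots are simple, and none lies in the finite set where injectivity
  -- fails.
  let h : K[X] := ∑ u, C (a u) * F u
  have heval : ∀ t, h.eval t = ∑ u, a u * (F u).eval t := fun t => by
    simp [h, eval_finsetSum]
  have hder : ∀ t, (derivative h).eval t = ∑ u, a u * (derivative (F u)).eval t := fun t => by
    simp [h, eval_finsetSum]
  have hcoeff : h.coeff d ≠ 0 := by simpa [h] using hlead
  have hnat : h.natDegree = d := by
    refine le_antisymm (natDegree_sum_le_of_forall_le _ _ fun u _ => ?_)
      (le_natDegree_of_ne_zero hcoeff)
    exact (natDegree_C_mul_le _ _).trans (hdeg u)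
  have h0 : h ≠ 0 := fun h0 => hcoeff (by rw [h0, coeff_zero])
  have hnodup : h.roots.Nodup := by
    classical
    rw [Multiset.nodup_iff_count_le_one]
    intro t
    rw [count_roots]
    by_contra hlt
    rw [not_le, one_lt_rootMultiplicity_iff_isRoot h0] at hlt
    exact hsimple t (heval t ▸ hlt.1) (hder t ▸ hlt.2)
  have hset : {p | p ∈ insert (Projectivization.mk K _ hinf)
      (Set.range fun t => Projectivization.mk K _ (hF t)) ∧ ∑ s, a s * p.rep s = 0} =
      (fun t => Projectivization.mk K _ (hF t)) '' {t | h.eval t = 0} := by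
    ext p
    constructor
    · rintro ⟨rfl | ⟨t, rfl⟩, hp⟩
      · rw [Projectivization.sum_mul_rep_eq_zero_iff] at hp
        exact absurd hp hlead
      · rw [Projectivization.sum_mul_rep_eq_zero_iff] at hp
        exact ⟨t, (heval t).trans hp, rfl⟩
    · rintro ⟨t, ht, rfl⟩
      refine ⟨Or.inr ⟨t, rfl⟩, ?_⟩
      rw [Projectivization.sum_mul_rep_eq_zero_iff, ← heval]
      exact ht
  have hinj : Set.InjOn (fun t => Projectivization.mk K _ (hF t)) {t | h.eval t = 0} := by
    intro t ht t' _ heq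
    by_contra hne
    rw [Projectivization.mk_eq_mk_iff] at heq
    obtain ⟨c, hc⟩ := heq
    refine hbad t' ⟨t, hne, c, fun u => (congrFun hc u).symm⟩ ?_
    rw [← heval]
    assumption
  rw [hset, hinj.encard_image]
  classical
  have hroots : {t | h.eval t = 0} = (h.roots.toFinset : Set K) := by
    ext t
    simp [h0]
  rw [hroots, Set.encard_coe_eq_coe_finsetCard, Multiset.toFinset_card_of_nodup hnodup,
    IsAlgClosed.card_roots_eq_natDegree, hnat]

/-! ### Parametrizations of Cayley curves -/

section CayleyCurve

variable {K : Type*} [Field K]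

theorem linForm_smul (g : Fin 2 → K) (c : K) (y : Fin 2 → K) :
    linForm g (c • y) = c * linForm g y := by
  simp only [linForm, Pi.smul_apply, smul_eq_mul]
  ring

variable {M : Type*} {τ : Set M} {ℓ d : ℕ} {A : Finset M} {π : τ → CayleySimplex ℓ d}
  {f : Fin (ℓ + 1) → Fin 2 → K}

theorem rhoVec_of_mem (y : Fin 2 → K) {u : A} (h : (u : M) ∈ τ) :
    rhoVec A π f y u = ∏ i, linForm (f i) y ^ (π ⟨u, h⟩).1 i := by
  simp [rhoVec, h]

theorem rhoVec_of_notMem (y : Fin 2 → K) {u : A} (h : (u : M) ∉ τ) :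
    rhoVec A π f y u = 0 := by
  simp [rhoVec, h]

theorem rhoVec_smul (c : K) (y : Fin 2 → K) :
    rhoVec A π f (c • y) = c ^ d • rhoVec A π f y := by
  funext u
  by_cases h : (u : M) ∈ τ
  · rw [Pi.smul_apply, rhoVec_of_mem _ h, rhoVec_of_mem _ h]
    simp only [linForm_smul, mul_pow, Finset.prod_mul_distrib, Finset.prod_pow_eq_pow_sum,
      (π ⟨u, h⟩).2, smul_eq_mul]
  · rw [Pi.smul_apply, rhoVec_of_notMem _ h, rhoVec_of_notMem _ h, smul_zero]

/-- At most one form `f i` vanishes at `y`, and basepoint-freeness supplies a monomial not involving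
it. -/
theorem rhoVec_ne_zero (hA : τ ⊆ A) (hπ : IsBasepointFree π) (hf : HasDistinctRoots f)
    {y : Fin 2 → K} (hy : y ≠ 0) : rhoVec A π f y ≠ 0 := by
  have hfree : ∀ i, ∃ u, (π u).1 i = 0 := by
    intro i
    by_contra hcon
    push Not at hcon
    exact hπ ⟨i, fun u => Nat.pos_of_ne_zero (hcon u)⟩
  obtain ⟨i, hi⟩ : ∃ i, ∀ j, j ≠ i → linForm (f j) y ≠ 0 := by
    by_cases h : ∃ i, linForm (f i) y = 0
    · obtain ⟨i, hi⟩ := h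
      exact ⟨i, fun j hj => hf.2 i j hj.symm y hy hi⟩
    · push Not at h
      exact ⟨0, fun j _ => h j⟩
  obtain ⟨u, hu⟩ := hfree i
  refine Function.ne_iff.mpr ⟨⟨u, hA u.2⟩, ?_⟩
  rw [rhoVec_of_mem _ u.2, Pi.zero_apply, Finset.prod_ne_zero_iff]
  intro j _
  by_cases hj : j = i
  · subst hj
    simp [hu]
  · exact pow_ne_zero _ (hi j hj)

open Classical in
/-- The coordinates of the parametrization `ρ_{π,f}` as binary forms. -/
noncomputable def rhoForm (A : Finset M) (π : τ → CayleySimplex ℓ d)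
    (f : Fin (ℓ + 1) → Fin 2 → K) (u : A) : MvPolynomial (Fin 2) K :=
  if h : (u : M) ∈ τ then ∏ i, (MvPolynomial.C (f i 0) * MvPolynomial.X 0 +
    MvPolynomial.C (f i 1) * MvPolynomial.X 1) ^ (π ⟨u, h⟩).1 i else 0

theorem eval_rhoForm (y : Fin 2 → K) (u : A) :
    MvPolynomial.eval y (rhoForm A π f u) = rhoVec A π f y u := by
  by_cases h : (u : M) ∈ τ
  · simp [rhoVec_of_mem _ h, rhoForm, h, linForm]
  · simp [rhoVec_of_notMem _ h, rhoForm, h]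

theorem isHomogeneous_rhoForm (u : A) : (rhoForm A π f u).IsHomogeneous d := by
  by_cases h : (u : M) ∈ τ
  · have := MvPolynomial.IsHomogeneous.prod Finset.univ (fun i => (MvPolynomial.C (f i 0) *
      MvPolynomial.X 0 + MvPolynomial.C (f i 1) * MvPolynomial.X 1 : MvPolynomial (Fin 2) K) ^
        (π ⟨u, h⟩).1 i) (fun i => 1 * (π ⟨u, h⟩).1 i) (fun i _ =>
        ((MvPolynomial.isHomogeneous_C_mul_X _ _).add
          (MvPolynomial.isHomogeneous_C_mul_X _ _)).pow _)
    simpa only [one_mul, (π ⟨u, h⟩).2, rhoForm, dif_pos h] using this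
  · simpa only [rhoForm, dif_neg h] using MvPolynomial.isHomogeneous_zero _ _ _

theorem cayleyCurve_eq_rhoImage [IsAlgClosed K] (hd : d ≠ 0) (hA : τ ⊆ A)
    (hπ : IsBasepointFree π) (hf : HasDistinctRoots f) :
    cayleyCurve A π f = rhoImage A π f := by
  refine zariskiClosure_range_eq (F := rhoForm A π f) hd isHomogeneous_rhoForm
    (fun y hy => ?_) _ ?_
  · obtain ⟨u, hu⟩ := Function.ne_iff.mp (rhoVec_ne_zero hA hπ hf hy)
    exact ⟨u, by rwa [eval_rhoForm]⟩
  · simp only [eval_rhoForm]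
    rfl

open Classical in
/-- The coordinates of the parametrization `ρ_{π,f}` on the affine chart `y_0 = 1`. -/
noncomputable def rhoPoly (A : Finset M) (π : τ → CayleySimplex ℓ d)
    (f : Fin (ℓ + 1) → Fin 2 → K) (u : A) : Polynomial K :=
  if h : (u : M) ∈ τ then ∏ i, (Polynomial.C (f i 0) +
    Polynomial.C (f i 1) * Polynomial.X) ^ (π ⟨u, h⟩).1 i else 0

theorem eval_rhoPoly (t : K) (u : A) :
    (rhoPoly A π f u).eval t = rhoVec A π f ![1, t] u := by
  by_cases h : (u : M) ∈ τ
  · simp [rhoVec_of_mem _ h, rhoPoly, h, linForm, Polynomial.eval_prod]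
  · simp [rhoVec_of_notMem _ h, rhoPoly, h]

theorem Polynomial.natDegree_C_add_C_mul_X_le (a b : K) :
    (Polynomial.C a + Polynomial.C b * Polynomial.X).natDegree ≤ 1 := by
  rw [add_comm]
  exact Polynomial.natDegree_linear_le

theorem natDegree_prod_linear_pow_le {ι : Type*} (s : Finset ι) (a b : ι → K) (m : ι → ℕ) :
    (∏ i ∈ s, (Polynomial.C (a i) + Polynomial.C (b i) * Polynomial.X) ^ m i).natDegree ≤
      ∑ i ∈ s, m i :=
  (Polynomial.natDegree_prod_le _ _).trans (Finset.sum_le_sum fun i _ => by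
    simpa using Polynomial.natDegree_pow_le_of_le (m i)
      (Polynomial.natDegree_C_add_C_mul_X_le (a i) (b i)))

theorem coeff_prod_linear_pow {ι : Type*} (s : Finset ι) (a b : ι → K) (m : ι → ℕ) :
    (∏ i ∈ s, (Polynomial.C (a i) + Polynomial.C (b i) * Polynomial.X) ^ m i).coeff
      (∑ i ∈ s, m i) = ∏ i ∈ s, b i ^ m i := by
  classical
  induction s using Finset.induction_on with
  | empty => simp
  | insert j s hj ih =>
    rw [Finset.prod_insert hj, Finset.sum_insert hj, Finset.prod_insert hj,
      Polynomial.coeff_mul_add_eq_of_natDegree_le _ (natDegree_prod_linear_pow_le s a b m), ih]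
    · congr 1
      have := Polynomial.coeff_pow_of_natDegree_le (m := m j)
        (Polynomial.natDegree_C_add_C_mul_X_le (a j) (b j))
      simpa using this
    · simpa using Polynomial.natDegree_pow_le_of_le (m j)
        (Polynomial.natDegree_C_add_C_mul_X_le (a j) (b j))

theorem natDegree_rhoPoly_le (u : A) : (rhoPoly A π f u).natDegree ≤ d := by
  by_cases h : (u : M) ∈ τ
  · rw [rhoPoly, dif_pos h]
    exact (natDegree_prod_linear_pow_le _ _ _ _).trans_eq (π ⟨u, h⟩).2
  · simp [rhoPoly, h]

/-- The coefficient in degree `d`, zero when the degree drops, is the coordinate at the point at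
infinity of the chart. -/
theorem coeff_rhoPoly (u : A) : (rhoPoly A π f u).coeff d = rhoVec A π f ![0, 1] u := by
  by_cases h : (u : M) ∈ τ
  · rw [rhoPoly, dif_pos h, rhoVec_of_mem _ h]
    have := coeff_prod_linear_pow Finset.univ (fun i => f i 0) (fun i => f i 1) (π ⟨u, h⟩).1
    rw [(π ⟨u, h⟩).2] at this
    simpa [linForm] using this
  · simp [rhoPoly, h, rhoVec_of_notMem _ h]

theorem cons_one_ne_zero (t : K) : (![1, t] : Fin 2 → K) ≠ 0 :=
  fun h => one_ne_zero (congrFun h 0)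

theorem cons_zero_one_ne_zero : (![0, 1] : Fin 2 → K) ≠ 0 :=
  fun h => one_ne_zero (congrFun h 1)

theorem rhoImage_eq_insert_range (hA : τ ⊆ A) (hπ : IsBasepointFree π)
    (hf : HasDistinctRoots f) :
    rhoImage A π f = insert (Projectivization.mk K _ (rhoVec_ne_zero hA hπ hf
      cons_zero_one_ne_zero)) (Set.range fun t => Projectivization.mk K _
        (rhoVec_ne_zero hA hπ hf (cons_one_ne_zero t))) := by
  ext p
  constructor
  · rintro ⟨y, hy, h, rfl⟩
    by_cases h0 : y 0 = 0
    · left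
      have h1 : y 1 ≠ 0 := by
        intro h1
        exact hy (by funext i; fin_cases i <;> assumption)
      have : y = y 1 • ![0, 1] := by funext i; fin_cases i <;> simp [h0]
      rw [Projectivization.mk_eq_mk_iff']
      refine ⟨y 1 ^ d, ?_⟩
      rw [← rhoVec_smul, ← this]
    · right
      have : y = y 0 • ![1, y 1 / y 0] := by
        funext i
        fin_cases i
        · simp
        · simp [mul_div_cancel₀ _ h0]
      refine ⟨y 1 / y 0, ?_⟩
      symm
      simp only [Projectivization.mk_eq_mk_iff']
      refine ⟨y 0 ^ d, ?_⟩
      rw [← rhoVec_smul, ← this]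
  · rintro (rfl | ⟨t, rfl⟩)
    · exact ⟨_, cons_zero_one_ne_zero, _, rfl⟩
    · exact ⟨_, cons_one_ne_zero t, _, rfl⟩

/-- If `ρ_{π,f}` is injective up to finitely many points, then the curve has degree `d`. -/
theorem hasDegree_cayleyCurve [IsAlgClosed K] [CharZero K] (hd : d ≠ 0) (hA : τ ⊆ A)
    (hπ : IsBasepointFree π) (hf : HasDistinctRoots f)
    (hfin : {t : K | ∃ t', t' ≠ t ∧ ∃ c : K,
      ∀ u, rhoVec A π f ![1, t'] u = c * rhoVec A π f ![1, t] u}.Finite) :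
    HasDegree (cayleyCurve A π f) d := by
  have h := hasDegree_of_parametrization (F := rhoPoly A π f) (d := d) natDegree_rhoPoly_le
    (by simpa only [coeff_rhoPoly] using rhoVec_ne_zero hA hπ hf cons_zero_one_ne_zero)
    (fun t => by simpa only [eval_rhoPoly] using rhoVec_ne_zero hA hπ hf (cons_one_ne_zero t))
    (by simpa only [eval_rhoPoly] using hfin)
  rw [cayleyCurve_eq_rhoImage hd hA hπ hf, rhoImage_eq_insert_range hA hπ hf]
  simpa only [eval_rhoPoly, coeff_rhoPoly] using h

end CayleyCurve

/-- General linear forms are nonzero with pairwise distinct roots. -/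
theorem forGeneral_hasDistinctRoots (K : Type*) [Field K] [CharZero K] (ℓ : ℕ) :
    ForGeneral fun c : Fin (ℓ + 1) × Fin 2 → K => HasDistinctRoots (Function.curry c) := by
  have hdet : ∀ p ∈ {p : Fin (ℓ + 1) × Fin (ℓ + 1) | p.1 ≠ p.2},
      ForGeneral fun c : Fin (ℓ + 1) × Fin 2 → K =>
        c (p.1, 0) * c (p.2, 1) - c (p.1, 1) * c (p.2, 0) ≠ 0 := by
    rintro ⟨i, j⟩ hij
    refine ⟨MvPolynomial.X (i, 0) * MvPolynomial.X (j, 1) -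
      MvPolynomial.X (i, 1) * MvPolynomial.X (j, 0), fun h => ?_, fun c hc => by simpa using hc⟩
    -- The forms with coefficients `(i, 1)` have minors `i - j`, nonzero in characteristic zero.
    have := congrArg (MvPolynomial.eval fun q : Fin (ℓ + 1) × Fin 2 =>
      if q.2 = 0 then ((q.1 : ℕ) : K) else 1) h
    simp only [map_sub, map_mul, MvPolynomial.eval_X, map_zero] at this
    have h2 : ((i : ℕ) : K) = ((j : ℕ) : K) := by simpa [sub_eq_zero] using this
    exact hij (Fin.ext (Nat.cast_injective h2))
  have hone : ∀ i ∈ (Set.univ : Set (Fin (ℓ + 1))),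
      ForGeneral fun c : Fin (ℓ + 1) × Fin 2 → K => c (i, 0) ≠ 0 := fun i _ =>
    ⟨MvPolynomial.X (i, 0), MvPolynomial.X_ne_zero _, fun c hc => by simpa using hc⟩
  refine ((ForGeneral.of_finite (Set.toFinite _) hdet).and
    (ForGeneral.of_finite Set.finite_univ hone)).mono ?_
  rintro c ⟨h1, h2⟩
  refine ⟨fun i h => h2 i trivial (congrFun h 0), fun i j hij y hy hi hj => hy ?_⟩
  have hne := h1 (i, j) hij
  simp only [linForm, Function.curry] at hi hj
  have e0 : (c (i, 0) * c (j, 1) - c (i, 1) * c (j, 0)) * y 0 = 0 := by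
    linear_combination c (j, 1) * hi - c (i, 1) * hj
  have e1 : (c (i, 0) * c (j, 1) - c (i, 1) * c (j, 0)) * y 1 = 0 := by
    linear_combination c (i, 0) * hj - c (j, 0) * hi
  funext k
  fin_cases k
  · exact (mul_eq_zero.mp e0).resolve_left hne
  · exact (mul_eq_zero.mp e1).resolve_left hne

/-! ### Generic injectivity -/

section Proportional

open Differential in
/-- If two points have the same image under all the Laurent monomials with exponents in a lattice,
and this persists in a generic family, then the lattice has rank at most one. Here `m u - m u'` are
the generators of the lattice. -/
theorem proportional_of_derivations {L : Type*} [Field L] [CharZero L] {ι τ : Type*} [Fintype ι]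
    (m : τ → ι → ℕ) (a b : ι → L) (t t' : L)
    (hD : ∀ j, ∃ D : Derivation ℤ L L, D (a j) = 1 ∧ (∀ i, i ≠ j → D (a i) = 0) ∧
      (∀ i, D (b i) = 0) ∧ D t = 0)
    (hb : ∀ i, b i ≠ 0) (ht : ∀ i, a i + b i * t ≠ 0) (ht' : ∀ i, a i + b i * t' ≠ 0)
    (hne : t ≠ t')
    (heq : ∀ u u', (∏ i, (a i + b i * t) ^ m u i) * ∏ i, (a i + b i * t') ^ m u' i =
      (∏ i, (a i + b i * t) ^ m u' i) * ∏ i, (a i + b i * t') ^ m u i)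
    (u u' v v' : τ) (j k : ι) :
    ((m u j : ℤ) - m u' j) * ((m v k : ℤ) - m v' k) =
      ((m u k : ℤ) - m u' k) * ((m v j : ℤ) - m v' j) := by
  classical
  -- Put `n = m u - m u'`. The logarithmic derivative along the `j`-th derivation of ∏ (a + b t)^n =
  -- ∏ (a + b t')^n gives n_j (1/(a_j + b_j t) - 1/(a_j + b_j t')) = D(t') S(n). Thus `n_j` is
  -- `S(n)` times a factor depending only on `j`.
  let S : τ → τ → L := fun u u' => ∑ i, ((m u i : L) - m u' i) * (b i / (a i + b i * t'))
  have key : ∀ j, ∃ α β : L, α ≠ 0 ∧ ∀ u u', ((m u j : L) - m u' j) * α = β * S u u' := by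
    intro j
    obtain ⟨D, hDj, hDi, hDb, hDt⟩ := hD j
    let _ : Differential L := ⟨D⟩
    have hderiv : ∀ x : L, x′ = D x := fun x => rfl
    have hDa : ∀ i, D (a i) = if i = j then 1 else 0 := fun i => by
      split_ifs with h
      · rw [h, hDj]
      · exact hDi i h
    have h1 : ∀ i, Differential.logDeriv (a i + b i * t) = if i = j then 1 / (a i + b i * t) else 0 := by
      intro i
      rw [Differential.logDeriv, hderiv, map_add, Derivation.leibniz, hDa, hDb, hDt]
      split_ifs <;> simp
    have h2 : ∀ i, Differential.logDeriv (a i + b i * t') =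
        (if i = j then 1 / (a i + b i * t') else 0) + D t' * (b i / (a i + b i * t')) := by
      intro i
      rw [Differential.logDeriv, hderiv, map_add, Derivation.leibniz, hDa, hDb, smul_zero, add_zero,
        smul_eq_mul, add_div]
      congr 1
      · split_ifs <;> simp
      · ring
    have hprod : ∀ (x : L) (_ : ∀ i, a i + b i * x ≠ 0) (u : τ),
        (∏ i, (a i + b i * x) ^ m u i) ≠ 0 ∧
        Differential.logDeriv (∏ i, (a i + b i * x) ^ m u i) = ∑ i, (m u i : L) * Differential.logDeriv (a i + b i * x) := by
      intro x hx u
      refine ⟨Finset.prod_ne_zero_iff.mpr fun i _ => pow_ne_zero _ (hx i), ?_⟩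
      rw [Differential.logDeriv_prod _ _ _ fun i _ => pow_ne_zero _ (hx i)]
      exact Finset.sum_congr rfl fun i _ => Differential.logDeriv_pow _ _
    refine ⟨1 / (a j + b j * t) - 1 / (a j + b j * t'), D t', ?_, fun u u' => ?_⟩
    · rw [sub_ne_zero]
      intro h
      rw [one_div, one_div, inv_inj] at h
      exact hne (mul_left_cancel₀ (hb j) (add_left_cancel h))
    · have h3 := congrArg Differential.logDeriv (heq u u')
      rw [Differential.logDeriv_mul _ _ (hprod t ht u).1 (hprod t' ht' u').1,
        Differential.logDeriv_mul _ _ (hprod t ht u').1 (hprod t' ht' u).1, (hprod t ht u).2,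
        (hprod t' ht' u').2, (hprod t ht u').2, (hprod t' ht' u).2] at h3
      simp only [h1, h2, mul_add, mul_ite, mul_zero, Finset.sum_add_distrib, Finset.sum_ite_eq',
        Finset.mem_univ, if_true] at h3
      have h4 : D t' * S u u' = ∑ i, (m u i : L) * (D t' * (b i / (a i + b i * t'))) -
          ∑ i, (m u' i : L) * (D t' * (b i / (a i + b i * t'))) := by
        rw [← Finset.sum_sub_distrib, Finset.mul_sum]
        exact Finset.sum_congr rfl fun i _ => by ring
      rw [h4]
      linear_combination h3
  obtain ⟨α, β, hα, hj⟩ := key j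
  obtain ⟨α', β', hα', hk⟩ := key k
  have h : ((m u j : L) - m u' j) * ((m v k : L) - m v' k) =
      ((m u k : L) - m u' k) * ((m v j : L) - m v' j) := by
    refine mul_right_cancel₀ (mul_ne_zero hα hα') ?_
    linear_combination ((m v k : L) - m v' k) * α' * hj u u' + β * S u u' * hk v v' -
      ((m v j : L) - m v' j) * α * hk u u' - β' * S u u' * hj v v'
  exact_mod_cast h

end Proportional

section GenericInjectivity

open MvPolynomial

/-- If the differences of the values of `π` are not all proportional, then for general linear forms
the parametrization is injective up to finitely many points. -/
theorem forGeneral_finite_of_not_proportional {K : Type*} [Field K] [CharZero K] {M : Type*}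
    {τ : Set M} {ℓ d : ℕ} {A : Finset M} {π : τ → CayleySimplex ℓ d} (hA : τ ⊆ A)
    (hfree : IsBasepointFree π) (hconc : IsConcise π)
    (hprop : ¬ ∀ (u u' v v' : τ) (j k : Fin (ℓ + 1)),
      (((π u).1 j : ℤ) - (π u').1 j) * (((π v).1 k : ℤ) - (π v').1 k) =
        (((π u).1 k : ℤ) - (π u').1 k) * (((π v).1 j : ℤ) - (π v').1 j)) :
    ForGeneral fun c : Fin (ℓ + 1) × Fin 2 → K => HasDistinctRoots (Function.curry c) →
      {t : K | ∃ t', t' ≠ t ∧ ∃ e : K, ∀ u, rhoVec A π (Function.curry c) ![1, t'] u =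
        e * rhoVec A π (Function.curry c) ![1, t] u}.Finite := by
  classical
  -- The left summand holds the coefficients and `t`, which stay generic; the right one holds `t'`
  -- and `z`, which are eliminated.
  let V := ((Fin (ℓ + 1) × Fin 2) ⊕ Unit) ⊕ Fin 2
  let t : MvPolynomial V K := X (Sum.inl (Sum.inr ()))
  let t' : MvPolynomial V K := X (Sum.inr 0)
  let z : MvPolynomial V K := X (Sum.inr 1)
  let lin : MvPolynomial V K → Fin (ℓ + 1) → MvPolynomial V K := fun T i =>
    X (Sum.inl (Sum.inl (i, 0))) + X (Sum.inl (Sum.inl (i, 1))) * T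
  let E : τ × τ → MvPolynomial V K := fun p =>
    (∏ i, lin t i ^ (π p.1).1 i) * ∏ i, lin t' i ^ (π p.2).1 i -
      (∏ i, lin t i ^ (π p.2).1 i) * ∏ i, lin t' i ^ (π p.1).1 i
  -- The equation `Z = 0` encodes that `t' ≠ t` and that no form vanishes at `t'`.
  let Z : MvPolynomial V K := z * ((t - t') * ∏ i, lin t' i) - 1
  obtain ⟨P, hP, hmem⟩ := MvPolynomial.exists_rename_inl_mem
    (Ideal.span (insert Z (Set.range E))) (by
      intro L _ _ x y hD hzero
      apply hprop
      have : CharZero L := charZero_of_injective_algebraMap (algebraMap K L).injective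
      have hZ := hzero Z (Ideal.subset_span (Set.mem_insert _ _))
      have hE := fun p => hzero (E p) (Ideal.subset_span (Set.mem_insert_of_mem _ ⟨p, rfl⟩))
      simp only [Z, E, lin, t, t', z, map_sub, map_mul, map_prod, map_add, map_pow, aeval_X,
        Sum.elim_inl, Sum.elim_inr, map_one, sub_eq_zero] at hZ hE
      have hZ' := right_ne_zero_of_mul (hZ ▸ one_ne_zero)
      have hne := left_ne_zero_of_mul hZ'
      have ht' := Finset.prod_ne_zero_iff.mp (right_ne_zero_of_mul hZ')
      refine proportional_of_derivations (L := L) (fun u => (π u).1)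
        (fun i => x (Sum.inl (i, 0))) (fun i => x (Sum.inl (i, 1))) (x (Sum.inr ())) (y 0)
        (fun j => ?_) (fun i => ?_) (fun i => ?_) (fun i => ht' i (Finset.mem_univ i))
        (sub_ne_zero.mp hne) (fun u u' => hE (u, u'))
      · obtain ⟨D, h1, h2⟩ := hD (Sum.inl (j, 0))
        exact ⟨D.restrictScalars ℤ, h1, fun i hi => h2 _ (by simpa using hi),
          fun i => h2 _ (by simp), h2 _ (by simp)⟩
      · obtain ⟨D, h1, -⟩ := hD (Sum.inl (i, 1))
        intro h
        rw [h, map_zero] at h1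
        exact zero_ne_one h1
      · obtain ⟨D, h1, h2⟩ := hD (Sum.inl (i, 0))
        intro h
        have h3 := congrArg D h
        rw [map_add, h1, Derivation.leibniz, h2 _ (by simp), h2 _ (by simp)] at h3
        simp at h3)
  have hvanish : ∀ (c : Fin (ℓ + 1) × Fin 2 → K) (s s' : K), s' ≠ s →
      (∀ i, linForm (Function.curry c i) ![1, s'] ≠ 0) →
      (∀ u u', (∏ i, linForm (Function.curry c i) ![1, s] ^ (π u).1 i) *
        ∏ i, linForm (Function.curry c i) ![1, s'] ^ (π u').1 i =
        (∏ i, linForm (Function.curry c i) ![1, s] ^ (π u').1 i) *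
        ∏ i, linForm (Function.curry c i) ![1, s'] ^ (π u).1 i) →
      eval (Sum.elim c fun _ => s) P = 0 := by
    intro c s s' hne hs' heq
    let pt : V → K := Sum.elim (Sum.elim c fun _ => s)
      ![s', ((s - s') * ∏ i, linForm (Function.curry c i) ![1, s'])⁻¹]
    have hlin : ∀ (T : MvPolynomial V K) i,
        eval pt (lin T i) = linForm (Function.curry c i) ![1, eval pt T] := by
      intro T i
      simp [lin, pt, linForm, Function.curry]
    have hle : Ideal.span (insert Z (Set.range E)) ≤ RingHom.ker (eval pt) := by
      rw [Ideal.span_le]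
      have h1 : eval pt t = s := by simp [t, pt]
      have h2 : eval pt t' = s' := by simp [t', pt]
      have h3 : eval pt z = ((s - s') * ∏ i, linForm (Function.curry c i) ![1, s'])⁻¹ := by
        simp [z, pt]
      rintro _ (rfl | ⟨p, rfl⟩)
      · rw [SetLike.mem_coe, RingHom.mem_ker]
        simp only [Z, map_sub, map_mul, map_prod, hlin, h1, h2, h3, map_one]
        rw [inv_mul_cancel₀ (mul_ne_zero (sub_ne_zero.mpr hne.symm)
          (Finset.prod_ne_zero_iff.mpr fun i _ => hs' i)), sub_self]
      · rw [SetLike.mem_coe, RingHom.mem_ker]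
        simp only [E, map_sub, map_mul, map_prod, map_pow, hlin, h1, h2]
        rw [heq, sub_self]
    have := hle hmem
    rwa [RingHom.mem_ker, eval_rename, Sum.elim_comp_inl] at this
  have : Infinite K := inferInstance
  obtain ⟨x, hx⟩ : ∃ x, eval x P ≠ 0 := by
    by_contra hcon
    push Not at hcon
    exact hP (MvPolynomial.funext fun x => by rw [hcon, map_zero])
  -- Freezing `t` at a value where `P` is not identically zero gives an open condition on the
  -- coefficients under which `P(c, ·)` is a nonzero polynomial, hence has finitely many roots.
  let Q : MvPolynomial (Fin (ℓ + 1) × Fin 2) K := aeval (Sum.elim X fun u => C (x (Sum.inr u))) P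
  have hQ : ∀ c, eval c Q = eval (Sum.elim c fun u => x (Sum.inr u)) P := by
    intro c
    have := comp_aeval_apply (f := (Sum.elim X fun u => C (x (Sum.inr u)) :
      (Fin (ℓ + 1) × Fin 2) ⊕ Unit → MvPolynomial (Fin (ℓ + 1) × Fin 2) K))
      (aeval c : MvPolynomial (Fin (ℓ + 1) × Fin 2) K →ₐ[K] K) P
    rw [aeval_eq_eval] at this
    rw [this, ← aeval_eq_eval]
    refine congrArg (fun g => aeval g P) (funext fun i => ?_)
    rcases i with i | i <;> simp
  refine ⟨Q, fun h => hx ?_, fun c hc hdist => ?_⟩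
  · have h1 := hQ (fun i => x (Sum.inl i))
    rw [h, map_zero] at h1
    rw [h1]
    congr 1
    congr 1
    funext i
    rcases i with i | i <;> rfl
  · let q : Polynomial K :=
      aeval (Sum.elim (fun i => Polynomial.C (c i)) fun _ => Polynomial.X) P
    have hq : ∀ s, q.eval s = eval (Sum.elim c fun _ => s) P := by
      intro s
      have := comp_aeval_apply (f := (Sum.elim (fun i => Polynomial.C (c i))
        fun _ => Polynomial.X : (Fin (ℓ + 1) × Fin 2) ⊕ Unit → Polynomial K))
        (Polynomial.aeval s : Polynomial K →ₐ[K] K) P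
      rw [Polynomial.coe_aeval_eq_eval] at this
      rw [this, ← aeval_eq_eval]
      refine congrArg (fun g => aeval g P) (funext fun i => ?_)
      rcases i with i | i <;> simp
    have hq0 : q ≠ 0 := by
      intro h0
      rw [hQ] at hc
      have := hq (x (Sum.inr ()))
      rw [h0, Polynomial.eval_zero] at this
      exact hc this.symm
    have hfin1 : {s : K | q.eval s = 0}.Finite :=
      (Polynomial.finite_setOfPred_isRoot hq0)
    have hfin2 : (⋃ i, {s : K | linForm (Function.curry c i) ![1, s] = 0}).Finite := by
      refine Set.finite_iUnion fun i => Set.Subsingleton.finite fun s hs s' hs' => ?_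
      simp only [linForm, Set.mem_ofPred_eq, Matrix.cons_val_zero, Matrix.cons_val_one,
        mul_one] at hs hs'
      have h1 : Function.curry c i 1 * (s - s') = 0 := by linear_combination hs - hs'
      rcases mul_eq_zero.mp h1 with h1 | h1
      · refine absurd ?_ (hdist.1 i)
        rw [h1, zero_mul, add_zero] at hs
        funext k
        fin_cases k
        · exact hs
        · exact h1
      · exact sub_eq_zero.mp h1
    -- A parameter at which injectivity fails is either the root of some form or a root of `P(c,
    -- ·)`.
    refine (hfin1.union hfin2).subset ?_
    rintro s ⟨s', hne, e, he⟩
    by_cases hs : ∃ i, linForm (Function.curry c i) ![1, s] = 0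
    · exact Or.inr (Set.mem_iUnion.mpr hs)
    push Not at hs
    have he0 : e ≠ 0 := by
      rintro rfl
      exact rhoVec_ne_zero hA hfree hdist (cons_one_ne_zero s') (by
        funext u
        rw [he, zero_mul, Pi.zero_apply])
    have heu : ∀ u, ∏ i, linForm (Function.curry c i) ![1, s'] ^ (π u).1 i =
        e * ∏ i, linForm (Function.curry c i) ![1, s] ^ (π u).1 i := by
      intro u
      have := he ⟨u, hA u.2⟩
      rwa [rhoVec_of_mem _ u.2, rhoVec_of_mem _ u.2] at this
    refine Or.inl ?_
    rw [Set.mem_ofPred_eq, hq]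
    refine hvanish c s s' hne (fun i hi => ?_) fun u u' => ?_
    -- By conciseness some monomial involves form `i`; it would vanish at `s'` but not at `s`,
    -- contradicting proportionality with a nonzero factor.
    · obtain ⟨u, hu⟩ := hconc i
      have h1 := heu u
      rw [Finset.prod_eq_zero (Finset.mem_univ i) (by rw [hi, zero_pow hu])] at h1
      exact mul_ne_zero he0 (Finset.prod_ne_zero_iff.mpr fun i _ => pow_ne_zero _ (hs i)) h1.symm
    · rw [heu, heu]
      ring

end GenericInjectivity

/-! ### Cayley structures with one-dimensional image -/

section OneDimensional

variable {M : Type*} {τ : Set M} {ℓ d : ℕ} {π : τ → CayleySimplex ℓ d}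

/-- The function `k : τ → {0, …, N}` is the lattice coordinate, with respect to the generator `w` of
the lattice, along the one-dimensional image of `π`, whose lattice length is `N`. -/
structure IsLinearCoordinate (π : τ → CayleySimplex ℓ d) (w : Fin (ℓ + 1) → ℤ) (k : τ → ℕ)
    (N : ℕ) : Prop where
  ne_zero : w ≠ 0
  span : diffLattice (imageSet π) = Submodule.span ℤ {w}
  bot : ∃ u, k u = 0
  top : ∃ u, k u = N
  le : ∀ u, k u ≤ N
  sub : ∀ u v i, ((π u).1 i : ℤ) - (π v).1 i = ((k u : ℤ) - k v) * w i

theorem sub_mem_diffLattice (u v : τ) :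
    (π u).toLattice - (π v).toLattice ∈ diffLattice (imageSet π) :=
  Submodule.subset_span ⟨_, ⟨u, rfl⟩, _, ⟨v, rfl⟩, rfl⟩

theorem diffLattice_imageSet_le {P : Submodule ℤ (Fin (ℓ + 1) → ℤ)}
    (h : ∀ u v, (π u).toLattice - (π v).toLattice ∈ P) : diffLattice (imageSet π) ≤ P := by
  refine Submodule.span_le.mpr ?_
  rintro _ ⟨_, ⟨u, rfl⟩, _, ⟨v, rfl⟩, rfl⟩
  exact h u v

theorem exists_isLinearCoordinate [Finite τ] [Nonempty τ] {w : Fin (ℓ + 1) → ℤ} (hw : w ≠ 0)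
    (hspan : diffLattice (imageSet π) = Submodule.span ℤ {w}) :
    ∃ k N, IsLinearCoordinate π w k N := by
  let v₀ : τ := Classical.arbitrary τ
  have h : ∀ u, ∃ n : ℤ, n • w = (π u).toLattice - (π v₀).toLattice := fun u =>
    Submodule.mem_span_singleton.mp (hspan ▸ sub_mem_diffLattice u v₀)
  choose n hn using h
  obtain ⟨u₀, hu₀⟩ := Finite.exists_min n
  obtain ⟨u₁, hu₁⟩ := Finite.exists_max n
  have hk : ∀ u, (((n u - n u₀).toNat : ℕ) : ℤ) = n u - n u₀ := fun u =>
    Int.toNat_of_nonneg (sub_nonneg.mpr (hu₀ u))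
  refine ⟨fun u => (n u - n u₀).toNat, (n u₁ - n u₀).toNat, hw, hspan, ⟨u₀, by simp⟩, ⟨u₁, rfl⟩,
    fun u => Int.toNat_le_toNat (sub_le_sub_right (hu₁ u) _), fun u v i => ?_⟩
  have h1 := congrFun (hn u) i
  have h2 := congrFun (hn v) i
  simp only [Pi.smul_apply, smul_eq_mul, Pi.sub_apply, CayleySimplex.toLattice] at h1 h2
  rw [hk, hk]
  linear_combination h2 - h1

namespace IsLinearCoordinate

variable {w : Fin (ℓ + 1) → ℤ} {k : τ → ℕ} {N : ℕ}

/-- The generator `w` is a combination of differences, so the values of `k`, which include 0, have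
greatest common divisor 1. -/
theorem eq_one_of_dvd (h : IsLinearCoordinate π w k N) {m : ℕ} (hm : ∀ u, m ∣ k u) : m = 1 := by
  have hw : w ∈ diffLattice (imageSet π) := h.span ▸ Submodule.mem_span_singleton_self w
  have hle : diffLattice (imageSet π) ≤ Submodule.span ℤ {(m : ℤ) • w} := by
    refine diffLattice_imageSet_le fun u v => ?_
    obtain ⟨a, ha⟩ := hm u
    obtain ⟨b, hb⟩ := hm v
    refine Submodule.mem_span_singleton.mpr ⟨(a : ℤ) - b, ?_⟩
    funext i
    have := h.sub u v i
    simp only [CayleySimplex.toLattice, Pi.sub_apply, this, ha, hb, Pi.smul_apply, smul_eq_mul]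
    push_cast
    ring
  obtain ⟨c, hc⟩ := Submodule.mem_span_singleton.mp (hle hw)
  obtain ⟨i, hi⟩ := Function.ne_iff.mp h.ne_zero
  have h1 := congrFun hc i
  simp only [Pi.smul_apply, smul_eq_mul] at h1
  have h2 : (m : ℤ) * c = 1 := mul_right_cancel₀ hi (by linear_combination h1)
  exact_mod_cast Int.eq_one_of_mul_eq_one_right (Int.natCast_nonneg m) h2

theorem pos (h : IsLinearCoordinate π w k N) : 0 < N := by
  -- If `N = 0` then every `k u` is 0 and so divisible by `m = 0`.
  refine Nat.pos_of_ne_zero fun h0 => zero_ne_one (h.eq_one_of_dvd (m := 0) fun u => ?_)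
  simpa [h0] using h.le u

theorem isLatticeLength (h : IsLinearCoordinate π w k N) :
    IsGreatest {j : ℕ | ∃ a ∈ imageSet π, ∃ b ∈ imageSet π, a - b = j • w} N := by
  constructor
  · obtain ⟨u, hu⟩ := h.top
    obtain ⟨v, hv⟩ := h.bot
    refine ⟨_, ⟨u, rfl⟩, _, ⟨v, rfl⟩, ?_⟩
    funext i
    have := h.sub u v i
    simpa [CayleySimplex.toLattice, hu, hv] using this
  · rintro j ⟨_, ⟨u, rfl⟩, _, ⟨v, rfl⟩, huv⟩
    obtain ⟨i, hi⟩ := Function.ne_iff.mp h.ne_zero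
    have h1 := congrFun huv i
    have h2 := h.sub u v i
    simp only [Pi.smul_apply, nsmul_eq_mul, Pi.sub_apply, CayleySimplex.toLattice] at h1
    rw [h2] at h1
    have h3 := mul_right_cancel₀ hi h1
    have := h.le u
    omega

/-- If `w i = 0`, coordinate `i` is constant; conciseness makes the constant positive, so `i` is a
basepoint. -/
theorem apply_ne_zero (h : IsLinearCoordinate π w k N) (hfree : IsBasepointFree π)
    (hconc : IsConcise π) (i : Fin (ℓ + 1)) : w i ≠ 0 := by
  intro hi
  obtain ⟨u, hu⟩ := hconc i
  refine hfree ⟨i, fun v => ?_⟩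
  have := h.sub u v i
  rw [hi, mul_zero] at this
  omega

/-- Coordinate `i` is affine in `k` with slope `w i`, nonnegative, and zero somewhere. It therefore
vanishes at the end `k = N` or `k = 0`, according to the sign of `w i`. -/
theorem apply_eq (h : IsLinearCoordinate π w k N) (hfree : IsBasepointFree π)
    (hconc : IsConcise π) (u : τ) (i : Fin (ℓ + 1)) :
    (π u).1 i = (N - k u) * (-w i).toNat + k u * (w i).toNat := by
  obtain ⟨v, hv⟩ : ∃ v, (π v).1 i = 0 := by
    by_contra hcon
    push Not at hcon
    exact hfree ⟨i, fun u => Nat.pos_of_ne_zero (hcon u)⟩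
  obtain ⟨u₀, hu₀⟩ := h.bot
  obtain ⟨u₁, hu₁⟩ := h.top
  zify [h.le u]
  rcases lt_or_gt_of_ne (h.apply_ne_zero hfree hconc i) with hi | hi
  · rw [Int.toNat_of_nonneg (by omega), Int.toNat_of_nonpos hi.le]
    have h1 := h.sub u₁ v i
    have h2 := h.sub u u₁ i
    have h3 : (π u₁).1 i = 0 := by
      have : (0 : ℤ) ≤ (N : ℤ) - k v := sub_nonneg.mpr (by exact_mod_cast h.le v)
      rw [hv, hu₁] at h1
      have h4 := mul_nonpos_of_nonneg_of_nonpos this hi.le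
      omega
    rw [h3, hu₁] at h2
    push_cast at h2 ⊢
    linear_combination h2
  · rw [Int.toNat_of_nonneg hi.le, Int.toNat_of_nonpos (by omega)]
    have h1 := h.sub u₀ v i
    have h2 := h.sub u u₀ i
    have h3 : (π u₀).1 i = 0 := by
      have : (k u₀ : ℤ) - k v ≤ 0 := by omega
      rw [hv] at h1
      have h4 := mul_nonpos_of_nonpos_of_nonneg this hi.le
      omega
    rw [h3, hu₀] at h2
    push_cast at h2 ⊢
    linear_combination h2

theorem mul_sum_toNat (h : IsLinearCoordinate π w k N) (hfree : IsBasepointFree π)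
    (hconc : IsConcise π) : N * ∑ i, (w i).toNat = d := by
  obtain ⟨u, hu⟩ := h.top
  rw [← (π u).2, Finset.mul_sum]
  refine Finset.sum_congr rfl fun i _ => ?_
  rw [h.apply_eq hfree hconc, hu, Nat.sub_self, zero_mul, zero_add]

theorem mul_sum_neg_toNat (h : IsLinearCoordinate π w k N) (hfree : IsBasepointFree π)
    (hconc : IsConcise π) : N * ∑ i, (-w i).toNat = d := by
  obtain ⟨u, hu⟩ := h.bot
  rw [← (π u).2, Finset.mul_sum]
  refine Finset.sum_congr rfl fun i _ => ?_
  rw [h.apply_eq hfree hconc, hu, zero_mul, add_zero, Nat.sub_zero]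

/-- The positive and negative parts of `w` both have sum `d / N`, so the sum of absolute values is
`2 d / N`. -/
theorem eq_degree_iff (h : IsLinearCoordinate π w k N) (hfree : IsBasepointFree π)
    (hconc : IsConcise π) (hd : 0 < d) :
    N = d ↔ ∑ i, (w i).natAbs = 2 := by
  have habs : ∑ i, (w i).natAbs = ∑ i, (w i).toNat + ∑ i, (-w i).toNat := by
    rw [← Finset.sum_add_distrib]
    exact Finset.sum_congr rfl fun i _ => by omega
  have h1 := h.mul_sum_toNat hfree hconc
  have h2 := h.mul_sum_neg_toNat hfree hconc
  have h3 : ∑ i, (w i).toNat = ∑ i, (-w i).toNat :=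
    Nat.eq_of_mul_eq_mul_left h.pos (h1.trans h2.symm)
  rw [habs, ← h3]
  constructor
  · intro hN
    rw [hN] at h1
    have := Nat.eq_of_mul_eq_mul_left hd (h1.trans (mul_one d).symm)
    omega
  · intro hs
    have : ∑ i, (w i).toNat = 1 := by omega
    rw [this, mul_one] at h1
    exact h1

end IsLinearCoordinate

end OneDimensional

/-! ### Rank-one lattices and primitivity -/

section Cyclic

variable {M : Type*} {τ : Set M} {ℓ d : ℕ} {π : τ → CayleySimplex ℓ d}

/-- All differences of values of `π` are pairwise proportional. -/
def HasProportionalDifferences (π : τ → CayleySimplex ℓ d) : Prop :=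
  ∀ (u u' v v' : τ) (j k : Fin (ℓ + 1)),
    (((π u).1 j : ℤ) - (π u').1 j) * (((π v).1 k : ℤ) - (π v').1 k) =
      (((π u).1 k : ℤ) - (π u').1 k) * (((π v).1 j : ℤ) - (π v').1 j)

theorem exists_apply_ne (h : ∃ u w, π u ≠ π w) : ∃ u w i, (π u).1 i ≠ (π w).1 i := by
  obtain ⟨u, w, h⟩ := h
  obtain ⟨i, hi⟩ := Function.ne_iff.mp fun h' => h (Subtype.ext h')
  exact ⟨u, w, i, hi⟩

/-- A coordinate `i` in which two values of π differ is injective on the line `P` containing all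
differences, so the lattice is isomorphic to an ideal of ℤ, which is principal. -/
theorem HasProportionalDifferences.exists_diffLattice_eq_span (h : HasProportionalDifferences π)
    (hπ : ∃ u w, π u ≠ π w) :
    ∃ w, w ≠ 0 ∧ diffLattice (imageSet π) = Submodule.span ℤ {w} := by
  obtain ⟨v, v', i, hi⟩ := exists_apply_ne hπ
  let P : Submodule ℤ (Fin (ℓ + 1) → ℤ) :=
    { carrier := {x | ∀ j, x j * (((π v).1 i : ℤ) - (π v').1 i) =
        x i * (((π v).1 j : ℤ) - (π v').1 j)}
      add_mem' := fun {x y} hx hy j => by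
        simp only [Pi.add_apply]
        linear_combination hx j + hy j
      zero_mem' := fun j => by simp
      smul_mem' := fun c x hx j => by
        simp only [Pi.smul_apply, smul_eq_mul]
        linear_combination c * hx j }
  have hP : ∀ x ∈ P, x i = 0 → x = 0 := by
    intro x hx hxi
    funext j
    have h1 := hx j
    rw [hxi, zero_mul] at h1
    exact (mul_eq_zero.mp h1).resolve_right (sub_ne_zero.mpr (by exact_mod_cast hi))
  have hle : diffLattice (imageSet π) ≤ P :=
    diffLattice_imageSet_le fun u u' j => h u u' v v' j i
  let J : Ideal ℤ := (diffLattice (imageSet π)).map (LinearMap.proj i)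
  obtain ⟨w, hw, hwg⟩ := Submodule.mem_map.mp (Submodule.IsPrincipal.generator_mem J)
  rw [LinearMap.proj_apply] at hwg
  have hspan : diffLattice (imageSet π) = Submodule.span ℤ {w} := by
    refine le_antisymm (fun x hx => ?_) ((Submodule.span_singleton_le_iff_mem _ _).mpr hw)
    have hxi : x i ∈ J := Submodule.mem_map.mpr ⟨x, hx, rfl⟩
    obtain ⟨c, hc⟩ := (Submodule.IsPrincipal.mem_iff_eq_smul_generator J).mp hxi
    refine Submodule.mem_span_singleton.mpr ⟨c, ?_⟩
    refine (sub_eq_zero.mp (hP (x - c • w) (P.sub_mem (hle hx) (P.smul_mem c (hle hw))) ?_)).symm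
    rw [Pi.sub_apply, Pi.smul_apply, hwg, hc, sub_self]
  refine ⟨w, ?_, hspan⟩
  rintro rfl
  have h1 := sub_mem_diffLattice (π := π) v v'
  rw [hspan, Submodule.span_singleton_eq_bot.mpr rfl, Submodule.mem_bot] at h1
  have h2 := congrFun h1 i
  simp only [Pi.sub_apply, CayleySimplex.toLattice, Pi.zero_apply, sub_eq_zero] at h2
  exact hi (by exact_mod_cast h2)

theorem exists_diffLattice_eq_span_of_latticeDim (h : latticeDim (imageSet π) = 1) :
    ∃ w, w ≠ 0 ∧ diffLattice (imageSet π) = Submodule.span ℤ {w} := by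
  let b := Module.finBasisOfFinrankEq ℤ (diffLattice (imageSet π)) h
  refine ⟨b 0, fun h0 => b.ne_zero 0 (Subtype.ext h0), le_antisymm (fun x hx => ?_)
    ((Submodule.span_singleton_le_iff_mem _ _).mpr (b 0).2)⟩
  refine Submodule.mem_span_singleton.mpr ⟨b.repr ⟨x, hx⟩ 0, ?_⟩
  have h1 := congrArg Subtype.val (b.sum_repr ⟨x, hx⟩)
  simpa using h1

theorem latticeDim_eq_one {w : Fin (ℓ + 1) → ℤ} (hw : w ≠ 0)
    (h : diffLattice (imageSet π) = Submodule.span ℤ {w}) : latticeDim (imageSet π) = 1 := by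
  rw [latticeDim, h, ← (LinearEquiv.toSpanNonzeroSingleton ℤ _ w hw).finrank_eq,
    Module.finrank_self]

theorem hasProportionalDifferences_of_length_one {π : τ → CayleySimplex 1 d} :
    HasProportionalDifferences π := by
  have hsum : ∀ u, ((π u).1 1 : ℤ) = d - (π u).1 0 := fun u => by
    have := (π u).2
    rw [Fin.sum_univ_two] at this
    omega
  intro u u' v v' j k
  fin_cases j <;> fin_cases k <;>
    simp only [Fin.zero_eta, Fin.mk_one, Fin.isValue, hsum] <;> ring

variable [AddCommGroup M]

theorem IsWeakCayleyStructure.degree_pos (hπ : IsWeakCayleyStructure π) : 0 < d := by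
  obtain ⟨u, w, i, hi⟩ := exists_apply_ne hπ.nonconstant
  have h1 := Finset.single_le_sum (f := (π u).1) (fun _ _ => Nat.zero_le _) (Finset.mem_univ i)
  have h2 := Finset.single_le_sum (f := (π w).1) (fun _ _ => Nat.zero_le _) (Finset.mem_univ i)
  rw [(π u).2] at h1
  rw [(π w).2] at h2
  omega

theorem IsCayleyStructure.length_pos (hπ : IsCayleyStructure π) : 0 < ℓ := by
  by_contra h
  obtain rfl : ℓ = 0 := by omega
  obtain ⟨u, w, h⟩ := hπ.nonconstant
  have hsum : ∀ u, (π u).1 0 = d := fun u => by simpa using (π u).2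
  refine h (Subtype.ext (funext fun i => ?_))
  rw [show i = 0 from Fin.fin_one_eq_zero i, hsum, hsum]

theorem IsImprimitive.exists_diffLattice_eq_span (h : IsImprimitive π)
    (hπ : IsCayleyStructure π) :
    ∃ w, w ≠ 0 ∧ diffLattice (imageSet π) = Submodule.span ℤ {w} := by
  rcases h with ⟨h, -⟩ | ⟨rfl, -⟩
  · exact exists_diffLattice_eq_span_of_latticeDim h
  · exact hasProportionalDifferences_of_length_one.exists_diffLattice_eq_span hπ.nonconstant

/-- Since no `w i` vanishes, the sum of the `|w i|` is at least ℓ + 1; it equals 2 only for ℓ = 1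
and w = ±(1, -1). For ℓ = 1 in general w = ±(m, -m), and `m > 1` is the divisibility in the
definition of imprimitive. -/
theorem IsLinearCoordinate.isPrimitive_iff {w : Fin (ℓ + 1) → ℤ} {k : τ → ℕ} {N : ℕ}
    (h : IsLinearCoordinate π w k N) (hπ : IsCayleyStructure π) : IsPrimitive π ↔ N = d := by
  rw [h.eq_degree_iff hπ.basepointFree hπ.concise hπ.degree_pos]
  have hne := h.apply_ne_zero hπ.basepointFree hπ.concise
  have hℓ := hπ.length_pos
  have hcard : ∀ m : ℕ, (∀ i, m ≤ (w i).natAbs) → (ℓ + 1) * m ≤ ∑ i, (w i).natAbs := by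
    intro m hm
    simpa using Finset.card_nsmul_le_sum Finset.univ (fun i => (w i).natAbs) m fun i _ => hm i
  constructor
  · intro hprim
    have hℓ1 : ℓ = 1 := by
      by_contra hne1
      exact hprim (Or.inl ⟨latticeDim_eq_one h.ne_zero h.span, by omega⟩)
    subst hℓ1
    have hw : w 0 + w 1 = 0 := by
      have h1 := h.mul_sum_toNat hπ.basepointFree hπ.concise
      have h2 := h.mul_sum_neg_toNat hπ.basepointFree hπ.concise
      have h3 := Nat.eq_of_mul_eq_mul_left h.pos (h1.trans h2.symm)
      rw [Fin.sum_univ_two, Fin.sum_univ_two] at h3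
      omega
    have hle : (w 0).natAbs ≤ 1 := by
      by_contra hgt
      refine hprim (Or.inr ⟨rfl, (w 0).natAbs, by omega, fun x hx i => ?_⟩)
      rw [h.span] at hx
      obtain ⟨c, rfl⟩ := Submodule.mem_span_singleton.mp hx
      rw [Pi.smul_apply, smul_eq_mul]
      refine Dvd.dvd.mul_left ?_ c
      rw [Int.natAbs_dvd]
      fin_cases i
      · exact dvd_rfl
      · exact ⟨-1, by simp only [Fin.mk_one]; omega⟩
    have := hne 0
    rw [Fin.sum_univ_two]
    omega
  · rintro hsum (⟨-, h1⟩ | ⟨rfl, m, hm, hdvd⟩)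
    · have := hcard 1 fun i => by have := hne i; omega
      omega
    · have := hcard 2 fun i => ?_
      · omega
      · have h1 := hdvd w (h.span ▸ Submodule.mem_span_singleton_self w) i
        have h2 := Nat.le_of_dvd (Int.natAbs_pos.mpr (hne i)) (Int.natCast_dvd.mp h1)
        omega

end Cyclic

/-! ### Reductions -/

section Reduction

variable {M : Type*} {τ : Set M} {ℓ d : ℕ} {π : τ → CayleySimplex ℓ d}

/-- Three-term relations suffice to determine an affine map on collinear points from its values at
the two ends. -/
theorem IsAffineLinear.smul_add_smul_add_smul {N N' : Type*} [AddCommGroup N] [AddCommGroup N']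
    {S : Set N} {g : S → N'} (hg : IsAffineLinear S g) (x y z : S) (a b c : ℤ)
    (h0 : a + b + c = 0) (h1 : a • (x : N) + b • (y : N) + c • (z : N) = 0) :
    a • g x + b • g y + c • g z = 0 := by
  have key : ∀ {G : Type _} [AddCommGroup G] (φ : S → G),
      ((Finsupp.single x a + Finsupp.single y b + Finsupp.single z c).sum fun u c => c • φ u) =
        a • φ x + b • φ y + c • φ z := by
    intro G _ φ
    rw [Finsupp.sum_add_index' (by simp) (fun _ _ _ => add_smul _ _ _),
      Finsupp.sum_add_index' (by simp) (fun _ _ _ => add_smul _ _ _)]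
    simp
  have key' : ((Finsupp.single x a + Finsupp.single y b + Finsupp.single z c).sum
      fun _ c => c) = a + b + c := by
    rw [Finsupp.sum_add_index' (by simp) (fun _ _ _ => rfl),
      Finsupp.sum_add_index' (by simp) (fun _ _ _ => rfl)]
    simp
  have := hg (Finsupp.single x a + Finsupp.single y b + Finsupp.single z c) (key'.trans h0) (by
    rw [Finsupp.sum_add_index' (by simp) (fun _ _ _ => add_smul _ _ _),
      Finsupp.sum_add_index' (by simp) (fun _ _ _ => add_smul _ _ _)]
    simpa using h1)
  rwa [key] at this

namespace IsLinearCoordinate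

variable {w : Fin (ℓ + 1) → ℤ} {k : τ → ℕ} {N : ℕ}

/-- The reduction of a Cayley structure defined by a linear coordinate on its image. -/
def reduction (h : IsLinearCoordinate π w k N) (u : τ) : CayleySimplex 1 N :=
  ⟨![N - k u, k u], by simp [Fin.sum_univ_two, h.le u]⟩

theorem isBasepointFree_reduction (h : IsLinearCoordinate π w k N) :
    IsBasepointFree h.reduction := by
  rintro ⟨i, hi⟩
  obtain ⟨u₀, hu₀⟩ := h.bot
  obtain ⟨u₁, hu₁⟩ := h.top
  fin_cases i
  · simpa [reduction, hu₁] using hi u₁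
  · simpa [reduction, hu₀] using hi u₀

/-- Because `w ≠ 0`, the coordinate `k` factors injectively through the image; it is affine there
since `k * w i` is coordinate `i` up to a constant, and a nonzero `w i` can be cancelled. -/
theorem isReduction (h : IsLinearCoordinate π w k N) : IsReduction π h.reduction := by
  refine ⟨⟨w, h.ne_zero, h.span, h.isLatticeLength⟩, ?_⟩
  have hs : ∀ b : imageSet π, ∃ u, (π u).toLattice = b := fun b => b.2
  choose s hs using hs
  have hk : ∀ u v, (π u).toLattice = (π v).toLattice ↔ k u = k v := by
    intro u v
    obtain ⟨i, hi⟩ := Function.ne_iff.mp h.ne_zero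
    constructor
    · intro huv
      have h1 := h.sub u v i
      have h2 : ((π u).1 i : ℤ) = (π v).1 i := congrFun huv i
      rw [h2, sub_self] at h1
      have h3 := (mul_eq_zero.mp h1.symm).resolve_right hi
      omega
    · intro huv
      funext j
      have h1 := h.sub u v j
      rw [huv, sub_self, zero_mul] at h1
      exact sub_eq_zero.mp h1
  refine ⟨fun b => h.reduction (s b), fun b c hbc => ?_, ?_, fun u => ?_⟩
  · have h1 := congrFun (congrArg Subtype.val hbc) 1
    exact Subtype.ext ((hs b).symm.trans (((hk _ _).mpr h1).trans (hs c)))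
  · intro a h0 h1
    obtain ⟨i, hi⟩ := Function.ne_iff.mp h.ne_zero
    obtain ⟨v, hv⟩ := h.bot
    have hval : ∀ b : imageSet π, (k (s b) : ℤ) * w i = (b : Fin (ℓ + 1) → ℤ) i - (π v).1 i := by
      intro b
      have h2 := h.sub (s b) v i
      have h3 := congrFun (hs b) i
      rw [CayleySimplex.toLattice] at h3
      rw [← h3, h2, hv]
      simp
    have hsum : (a.sum fun b c => c * (k (s b) : ℤ)) = 0 := by
      refine (mul_eq_zero.mp ?_).resolve_right hi
      have h2 := congrFun h1 i
      rw [Finsupp.sum, Finset.sum_apply, Pi.zero_apply] at h2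
      simp only [Pi.smul_apply, smul_eq_mul] at h2
      rw [Finsupp.sum] at h0 ⊢
      rw [Finset.sum_mul]
      simp only [mul_assoc, hval, mul_sub, Finset.sum_sub_distrib, ← Finset.sum_mul, h0, h2]
      simp
    have hsum' : (a.sum fun b c => c * ((N - k (s b) : ℕ) : ℤ)) = 0 := by
      rw [Finsupp.sum] at h0 hsum ⊢
      simp only [Nat.cast_sub (h.le _), mul_sub, Finset.sum_sub_distrib, ← Finset.sum_mul, h0,
        hsum]
      simp
    funext j
    rw [Finsupp.sum, Finset.sum_apply]
    fin_cases j
    · simpa [Finsupp.sum, CayleySimplex.toLattice, reduction] using hsum'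
    · simpa [Finsupp.sum, CayleySimplex.toLattice, reduction] using hsum
  · have h1 : k (s ⟨(π u).toLattice, Set.mem_range_self u⟩) = k u := (hk _ _).mp (hs _)
    apply Subtype.ext
    simp only [reduction, h1]

/-- A reduction is unique up to exchanging the two coordinates. -/
theorem apply_of_isReduction (h : IsLinearCoordinate π w k N) {π' : τ → CayleySimplex 1 N}
    (hred : IsReduction π π') :
    (∀ u, (π' u).1 0 = N - k u ∧ (π' u).1 1 = k u) ∨
      (∀ u, (π' u).1 0 = k u ∧ (π' u).1 1 = N - k u) := by
  obtain ⟨-, ψ, hinj, haff, hψ⟩ := hred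
  obtain ⟨u₀, hu₀⟩ := h.bot
  obtain ⟨u₁, hu₁⟩ := h.top
  have hsum : ∀ u, (π' u).1 0 + (π' u).1 1 = N := fun u => by
    have := (π' u).2
    rwa [Fin.sum_univ_two] at this
  -- Interpolation between the end points `u₀` and `u₁` of the image.
  have hrel : ∀ u, (N : ℤ) * (π' u).1 1 =
      (N - k u) * (π' u₀).1 1 + k u * (π' u₁).1 1 := by
    intro u
    have h1 := haff.smul_add_smul_add_smul ⟨_, Set.mem_range_self u⟩ ⟨_, Set.mem_range_self u₀⟩
      ⟨_, Set.mem_range_self u₁⟩ (N : ℤ) (-((N : ℤ) - k u)) (-(k u : ℤ)) (by ring) (by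
        funext i
        have h2 := h.sub u u₀ i
        have h3 := h.sub u₁ u₀ i
        simp only [CayleySimplex.toLattice, Pi.add_apply, Pi.smul_apply, smul_eq_mul,
          Pi.zero_apply]
        rw [hu₀] at h2 h3
        rw [hu₁] at h3
        push_cast at h2 h3
        linear_combination (N : ℤ) * h2 - (k u : ℤ) * h3)
    rw [← hψ, ← hψ, ← hψ] at h1
    have h2 := congrFun h1 1
    simp only [CayleySimplex.toLattice, Pi.add_apply, Pi.smul_apply, smul_eq_mul,
      Pi.zero_apply] at h2
    linear_combination h2
  have hne : (π' u₀).1 1 ≠ (π' u₁).1 1 := by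
    intro heq
    have h1 : π' u₀ = π' u₁ := by
      apply Subtype.ext
      funext i
      fin_cases i
      · have := hsum u₀
        have := hsum u₁
        simp only [Fin.zero_eta]
        omega
      · exact heq
    rw [hψ, hψ] at h1
    have h2 := Subtype.ext_iff.mp (hinj h1)
    obtain ⟨i, hi⟩ := Function.ne_iff.mp h.ne_zero
    have h3 := h.sub u₁ u₀ i
    have h4 : ((π u₀).1 i : ℤ) = (π u₁).1 i := congrFun h2 i
    rw [h4, sub_self, hu₀, hu₁] at h3
    have h5 := (mul_eq_zero.mp h3.symm).resolve_right hi
    have := h.pos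
    omega
  -- Let `e` be the distance between the end values. Interpolation gives `N ∣ k u * e` for all `u`,
  -- so `N / gcd(N, e)` divides every `k u` and is 1. Thus `N ∣ e`, and as `0 < e ≤ N` the end
  -- values are 0 and `N` in some order.
  have hdvd : N ∣ (((π' u₁).1 1 : ℤ) - (π' u₀).1 1).natAbs := by
    set e := (((π' u₁).1 1 : ℤ) - (π' u₀).1 1).natAbs with he
    have hke : ∀ u, N ∣ k u * e := by
      intro u
      have h1 : (N : ℤ) ∣ (k u : ℤ) * (((π' u₁).1 1 : ℤ) - (π' u₀).1 1) :=
        ⟨(π' u).1 1 - (π' u₀).1 1, by linear_combination -hrel u⟩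
      rw [Int.natCast_dvd, Int.natAbs_mul, Int.natAbs_natCast] at h1
      exact h1
    have hg : 0 < Nat.gcd N e := Nat.gcd_pos_of_pos_left _ h.pos
    have h1 : N / Nat.gcd N e = 1 := by
      refine h.eq_one_of_dvd fun u => ?_
      refine (Nat.coprime_div_gcd_div_gcd hg).dvd_of_dvd_mul_right ?_
      rw [← Nat.mul_div_assoc _ (Nat.gcd_dvd_right _ _)]
      exact Nat.div_dvd_div (Nat.gcd_dvd_left _ _) (hke u)
    have h2 : N = Nat.gcd N e := by
      have := Nat.div_mul_cancel (Nat.gcd_dvd_left N e)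
      rwa [h1, one_mul, eq_comm] at this
    rw [h2]
    exact Nat.gcd_dvd_right _ _
  have hle := Nat.le_of_dvd (by omega) hdvd
  have hs₀ := hsum u₀
  have hs₁ := hsum u₁
  have hN : (N : ℤ) ≠ 0 := by exact_mod_cast h.pos.ne'
  rcases lt_or_gt_of_ne hne with hlt | hlt
  · left
    intro u
    have h0 : (π' u₀).1 1 = 0 := by omega
    have h1 : (π' u₁).1 1 = N := by omega
    have h2 := hrel u
    rw [h0, h1] at h2
    have h3 : ((π' u).1 1 : ℤ) = k u := mul_left_cancel₀ hN (by push_cast at h2; linear_combination h2)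
    have := hsum u
    omega
  · right
    intro u
    have h0 : (π' u₀).1 1 = N := by omega
    have h1 : (π' u₁).1 1 = 0 := by omega
    have h2 := hrel u
    rw [h0, h1] at h2
    have h3 : ((π' u).1 1 : ℤ) = N - k u :=
      mul_left_cancel₀ hN (by push_cast at h2; linear_combination h2)
    have := hsum u
    omega

end IsLinearCoordinate

end Reduction

/-! ### Curves of Cayley structures with one-dimensional image -/

section MonomialCurve

variable {K : Type*} [Field K] {M : Type*} {τ : Set M} {ℓ d : ℕ} {A : Finset M}

open Classical in
/-- The vector of monomials `s_0^{N-k(u)} s_1^{k(u)}`, with entry `0` for `u ∉ τ`. -/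
noncomputable def monomialVec (A : Finset M) (k : τ → ℕ) (N : ℕ) (s : Fin 2 → K) : A → K :=
  fun u => if h : (u : M) ∈ τ then s 0 ^ (N - k ⟨u, h⟩) * s 1 ^ k ⟨u, h⟩ else 0

/-- The image of `ℙ^1` under the monomial map with exponents `k`. -/
def monomialImage (K : Type*) [Field K] (A : Finset M) (k : τ → ℕ) (N : ℕ) :
    Set (Projectivization K (A → K)) :=
  {p | ∃ s : Fin 2 → K, s ≠ 0 ∧ ∃ h : monomialVec A k N s ≠ 0, p = Projectivization.mk K _ h}

theorem monomialVec_smul {k : τ → ℕ} {N : ℕ} (hk : ∀ u, k u ≤ N) (c : K) (s : Fin 2 → K) :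
    monomialVec A k N (c • s) = c ^ N • monomialVec A k N s := by
  funext u
  by_cases h : (u : M) ∈ τ
  · simp only [monomialVec, h, dif_pos, Pi.smul_apply, smul_eq_mul, mul_pow]
    have : c ^ N = c ^ (N - k ⟨u, h⟩) * c ^ k ⟨u, h⟩ := by
      rw [← pow_add, Nat.sub_add_cancel (hk _)]
    rw [this]
    ring
  · simp [monomialVec, h]

/-- Two coprime products of linear forms of the same degree define a surjection of `ℙ^1`. -/
theorem exists_prod_linForm_eq_smul [IsAlgClosed K] {f : Fin (ℓ + 1) → Fin 2 → K}
    {p q : Fin (ℓ + 1) → ℕ} {e : ℕ} (he : e ≠ 0) (hp : ∑ i, p i = e) (hq : ∑ i, q i = e)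
    (hne : ∀ y : Fin 2 → K, y ≠ 0 →
      ¬ (∏ i, linForm (f i) y ^ p i = 0 ∧ ∏ i, linForm (f i) y ^ q i = 0))
    {s : Fin 2 → K} (hs : s ≠ 0) :
    ∃ y : Fin 2 → K, y ≠ 0 ∧ ∃ c : K, c ≠ 0 ∧
      ![∏ i, linForm (f i) y ^ p i, ∏ i, linForm (f i) y ^ q i] = c • s := by
  obtain ⟨y, hy, hrel⟩ : ∃ y : Fin 2 → K, y ≠ 0 ∧
      s 0 * ∏ i, linForm (f i) y ^ q i = s 1 * ∏ i, linForm (f i) y ^ p i := by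
    let P : (Fin (ℓ + 1) → ℕ) → Polynomial K := fun m =>
      ∏ i, (Polynomial.C (f i 0) + Polynomial.C (f i 1) * Polynomial.X) ^ m i
    have heval : ∀ m t, (P m).eval t = ∏ i, linForm (f i) ![1, t] ^ m i := fun m t => by
      simp [P, Polynomial.eval_prod, linForm]
    have hcoeff : ∀ m, ∑ i, m i = e → (P m).coeff e = ∏ i, linForm (f i) ![0, 1] ^ m i := by
      rintro m rfl
      simpa [linForm] using
        coeff_prod_linear_pow Finset.univ (fun i => f i 0) (fun i => f i 1) m
    let r := Polynomial.C (s 0) * P q - Polynomial.C (s 1) * P p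
    -- A nonzero constant `r` has no root in the chart, but then its coefficient in degree `e > 0`,
    -- its value at infinity, vanishes. The zero polynomial has degree `⊥` and falls into the other
    -- case.
    by_cases hr : r.degree = 0
    · refine ⟨_, cons_zero_one_ne_zero, ?_⟩
      have h1 : r.coeff e = 0 := by
        refine Polynomial.coeff_eq_zero_of_degree_lt ?_
        rw [hr]
        exact_mod_cast Nat.pos_of_ne_zero he
      rw [← hcoeff q hq, ← hcoeff p hp]
      simpa [r, sub_eq_zero] using h1
    · obtain ⟨t, ht⟩ := IsAlgClosed.exists_root r hr
      refine ⟨_, cons_one_ne_zero t, ?_⟩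
      rw [← heval, ← heval]
      simpa [r, sub_eq_zero] using ht
  refine ⟨y, hy, ?_⟩
  have hne := hne y hy
  set P := ∏ i, linForm (f i) y ^ p i
  set Q := ∏ i, linForm (f i) y ^ q i
  by_cases h0 : s 0 = 0
  · have h1 : s 1 ≠ 0 := by
      intro h1
      exact hs (by funext i; fin_cases i <;> assumption)
    have hP : P = 0 := by
      rw [h0, zero_mul, eq_comm] at hrel
      exact (mul_eq_zero.mp hrel).resolve_left h1
    refine ⟨Q / s 1, div_ne_zero (fun hQ => hne ⟨hP, hQ⟩) h1, ?_⟩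
    funext i
    fin_cases i
    · simp [h0, hP]
    · simp [h1]
  · have hQ : Q = P / s 0 * s 1 := by
      field_simp
      linear_combination hrel
    refine ⟨P / s 0, div_ne_zero (fun hP => hne ⟨hP, by rw [hQ, hP]; simp⟩) h0, ?_⟩
    funext i
    fin_cases i
    · simp [h0]
    · simpa using hQ

/-- A Cayley structure whose image lies on a line has the same curve as a monomial map. -/
theorem rhoImage_eq_monomialImage [IsAlgClosed K] {π : τ → CayleySimplex ℓ d}
    {f : Fin (ℓ + 1) → Fin 2 → K} (hf : HasDistinctRoots f) {k : τ → ℕ} {N : ℕ}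
    (hk : ∀ u, k u ≤ N) {p q : Fin (ℓ + 1) → ℕ} {e : ℕ} (he : e ≠ 0) (hp : ∑ i, p i = e)
    (hq : ∑ i, q i = e) (hpq : ∀ i, p i = 0 ∨ q i = 0)
    (hπ : ∀ u i, (π u).1 i = (N - k u) * p i + k u * q i) :
    rhoImage A π f = monomialImage K A k N := by
  have hne : ∀ y : Fin 2 → K, y ≠ 0 →
      ¬ (∏ i, linForm (f i) y ^ p i = 0 ∧ ∏ i, linForm (f i) y ^ q i = 0) := by
    rintro y hy ⟨h1, h2⟩
    obtain ⟨i, -, hi⟩ := Finset.prod_eq_zero_iff.mp h1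
    obtain ⟨j, -, hj⟩ := Finset.prod_eq_zero_iff.mp h2
    rw [pow_eq_zero_iff'] at hi hj
    have hij : i ≠ j := by
      rintro rfl
      rcases hpq i with h | h
      · exact hi.2 h
      · exact hj.2 h
    exact hf.2 i j hij y hy hi.1 hj.1
  -- The parametrization factors through the monomial map; the two images agree because the first
  -- factor is a surjection of ℙ¹.
  have hvec : ∀ y, rhoVec A π f y = monomialVec A k N
      ![∏ i, linForm (f i) y ^ p i, ∏ i, linForm (f i) y ^ q i] := by
    intro y
    funext u
    by_cases h : (u : M) ∈ τ
    · rw [rhoVec_of_mem _ h]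
      simp only [monomialVec, h, dif_pos, Matrix.cons_val_zero, Matrix.cons_val_one,
        ← Finset.prod_pow, ← Finset.prod_mul_distrib]
      refine Finset.prod_congr rfl fun i _ => ?_
      rw [hπ, pow_add, ← pow_mul, ← pow_mul, mul_comm (p i), mul_comm (q i)]
    · simp [rhoVec_of_notMem _ h, monomialVec, h]
  ext x
  constructor
  · rintro ⟨y, hy, h, rfl⟩
    refine ⟨![∏ i, linForm (f i) y ^ p i, ∏ i, linForm (f i) y ^ q i], fun h0 => hne y hy
      ⟨congrFun h0 0, congrFun h0 1⟩, hvec y ▸ h, ?_⟩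
    simp only [hvec]
  · rintro ⟨s, hs, h, rfl⟩
    obtain ⟨y, hy, c, hc, hyc⟩ := exists_prod_linForm_eq_smul he hp hq hne hs
    have hval : rhoVec A π f y = c ^ N • monomialVec A k N s := by
      rw [hvec, hyc, monomialVec_smul hk]
    refine ⟨y, hy, ?_, ?_⟩
    · rw [hval]
      exact smul_ne_zero (pow_ne_zero _ hc) h
    · symm
      rw [Projectivization.mk_eq_mk_iff']
      exact ⟨c ^ N, hval.symm⟩

variable {π : τ → CayleySimplex ℓ d} {w : Fin (ℓ + 1) → ℤ} {k : τ → ℕ} {N : ℕ}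

namespace IsLinearCoordinate

theorem rhoImage_eq [IsAlgClosed K] [AddCommGroup M] (h : IsLinearCoordinate π w k N)
    (hπ : IsCayleyStructure π) {f : Fin (ℓ + 1) → Fin 2 → K} (hf : HasDistinctRoots f) :
    rhoImage A π f = monomialImage K A k N := by
  have h1 := h.mul_sum_toNat hπ.basepointFree hπ.concise
  have h2 := h.mul_sum_neg_toNat hπ.basepointFree hπ.concise
  refine rhoImage_eq_monomialImage hf h.le (fun h0 => ?_) rfl
    (Nat.eq_of_mul_eq_mul_left h.pos (h1.trans h2.symm)) (fun i => by omega)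
    (h.apply_eq hπ.basepointFree hπ.concise)
  rw [h0, mul_zero] at h2
  exact hπ.degree_pos.ne h2

theorem rhoImage_eq_of_isReduction [IsAlgClosed K] (h : IsLinearCoordinate π w k N)
    {π' : τ → CayleySimplex 1 N} (hred : IsReduction π π') {g : Fin 2 → Fin 2 → K}
    (hg : HasDistinctRoots g) : rhoImage A π' g = monomialImage K A k N := by
  rcases h.apply_of_isReduction hred with hπ' | hπ'
  · refine rhoImage_eq_monomialImage hg h.le (p := ![1, 0]) (q := ![0, 1]) one_ne_zero
      (by simp [Fin.sum_univ_two]) (by simp [Fin.sum_univ_two]) (fun i => ?_) (fun u i => ?_)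
    · fin_cases i <;> simp
    · fin_cases i
      · simpa using (hπ' u).1
      · simpa using (hπ' u).2
  · refine rhoImage_eq_monomialImage hg h.le (p := ![0, 1]) (q := ![1, 0]) one_ne_zero
      (by simp [Fin.sum_univ_two]) (by simp [Fin.sum_univ_two]) (fun i => ?_) (fun u i => ?_)
    · fin_cases i <;> simp
    · fin_cases i
      · simpa using (hπ' u).1
      · simpa using (hπ' u).2

/-- The curve is that of the reduction with the coordinate forms, whose parametrization has degree
exactly `N` and is injective away from `t = 0` and infinity. -/
theorem hasDegree_cayleyCurve [IsAlgClosed K] [CharZero K] [AddCommGroup M]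
    (h : IsLinearCoordinate π w k N) (hπ : IsCayleyStructure π) (hA : τ ⊆ A)
    {f : Fin (ℓ + 1) → Fin 2 → K} (hf : HasDistinctRoots f) :
    HasDegree (cayleyCurve A π f) N := by
  let g : Fin 2 → Fin 2 → K := ![![1, 0], ![0, 1]]
  have hg0 : ∀ y, linForm (g 0) y = y 0 := fun y => by simp [g, linForm]
  have hg1 : ∀ y, linForm (g 1) y = y 1 := fun y => by simp [g, linForm]
  have hg : HasDistinctRoots g := by
    refine ⟨fun i hi => ?_, fun i j hij y hy hi hj => hy ?_⟩
    · fin_cases i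
      · exact one_ne_zero (congrFun hi 0)
      · exact one_ne_zero (congrFun hi 1)
    · have hall : ∀ k, linForm (g k) y = 0 := by
        intro k
        have : k = i ∨ k = j := by omega
        rcases this with rfl | rfl <;> assumption
      funext k
      fin_cases k
      · exact (hg0 y).symm.trans (hall 0)
      · exact (hg1 y).symm.trans (hall 1)
  have hcurve : cayleyCurve A π f = cayleyCurve A h.reduction g := by
    rw [cayleyCurve, cayleyCurve, h.rhoImage_eq hπ hf, h.rhoImage_eq_of_isReduction
      h.isReduction hg]
  rw [hcurve]
  refine _root_.hasDegree_cayleyCurve h.pos.ne' hA h.isBasepointFree_reduction hg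
    ((Set.finite_singleton (0 : K)).subset ?_)
  rintro t ⟨t', hne, c, hc⟩
  by_contra ht
  have ht0 : t ≠ 0 := ht
  have hpow : ∀ u, t' ^ k u = c * t ^ k u := by
    intro u
    have h1 := hc ⟨u, hA u.2⟩
    rw [rhoVec_of_mem _ u.2, rhoVec_of_mem _ u.2, Fin.prod_univ_two, Fin.prod_univ_two] at h1
    simpa [hg0, hg1, reduction] using h1
  obtain ⟨u₀, hu₀⟩ := h.bot
  have hc1 : c = 1 := by
    have := hpow u₀
    rw [hu₀, pow_zero, pow_zero, mul_one] at this
    exact this.symm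
  -- The order of `t' / t` divides every `k u`, hence is 1.
  refine hne ((div_eq_one_iff_eq ht0).mp (orderOf_eq_one_iff.mp (h.eq_one_of_dvd fun u => ?_)))
  refine orderOf_dvd_of_pow_eq_one ?_
  rw [div_pow, hpow, hc1, one_mul, div_self (pow_ne_zero _ ht0)]

end IsLinearCoordinate

end MonomialCurve

/-- Over an infinite field two nonempty open sets of hyperplanes meet. -/
theorem HasDegree.unique {K σ : Type*} [Field K] [Infinite K] [Fintype σ]
    {C : Set (Projectivization K (σ → K))} {m n : ℕ} (hm : HasDegree C m) (hn : HasDegree C n) :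
    m = n := by
  obtain ⟨x, h1, h2⟩ := (ForGeneral.and hm hn).exists
  exact_mod_cast h1.symm.trans h2

theorem mainTheorem2 {K : Type*} [Field K] [IsAlgClosed K] [CharZero K]
    {M : Type*} [AddCommGroup M] [Module.Free ℤ M] [Module.Finite ℤ M]
    (A : Finset M) (τ : Set M) (hτ : IsFace A τ)
    (ℓ d : ℕ) (π : τ → CayleySimplex ℓ d) (hπ : IsCayleyStructure π) :
    ((ForGeneral fun c : Fin (ℓ + 1) × Fin 2 → K =>
        HasDegree (cayleyCurve A π (Function.curry c)) d) ↔ IsPrimitive π) ∧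
    (IsImprimitive π →
      (∃ (d' : ℕ) (π' : τ → CayleySimplex 1 d'), IsReduction π π') ∧
      ∀ (d' : ℕ) (π' : τ → CayleySimplex 1 d'), IsReduction π π' →
        ∀ f : Fin (ℓ + 1) → Fin 2 → K, HasDistinctRoots f →
          (∀ g : Fin 2 → Fin 2 → K, HasDistinctRoots g →
            cayleyCurve A π f = cayleyCurve A π' g) ∧
          HasDegree (cayleyCurve A π f) d') := by
  have hA : τ ⊆ A := by
    obtain ⟨φ, rfl⟩ := hτ
    exact fun u hu => hu.1
  have hfinite : Finite τ := A.finite_toSet.subset hA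
  have hnonempty : Nonempty τ := ⟨hπ.nonconstant.choose⟩
  have hcoord : (∃ w, w ≠ 0 ∧ diffLattice (imageSet π) = Submodule.span ℤ {w}) →
      ∃ w k N, IsLinearCoordinate π w k N := by
    rintro ⟨w, hw, hspan⟩
    exact ⟨w, exists_isLinearCoordinate hw hspan⟩
  have hdist := forGeneral_hasDistinctRoots K ℓ
  refine ⟨⟨fun hdeg hprim => ?_, fun hprim => ?_⟩, fun himp => ⟨?_, fun d' π' hred f hf => ?_⟩⟩
  -- An imprimitive structure has curve degree `N` for all forms with distinct roots; general degree
  -- `d` would give `N = d`, that is, primitivity.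
  · obtain ⟨w, k, N, h⟩ := hcoord (hprim.exists_diffLattice_eq_span hπ)
    obtain ⟨c, hc, hcd⟩ := (hdeg.and hdist).exists
    exact (h.isPrimitive_iff hπ).mpr ((h.hasDegree_cayleyCurve hπ hA hcd).unique hc) hprim
  · by_cases hprop : HasProportionalDifferences π
    · obtain ⟨w, k, N, h⟩ := hcoord (hprop.exists_diffLattice_eq_span hπ.nonconstant)
      obtain rfl := (h.isPrimitive_iff hπ).mp hprim
      exact hdist.mono fun c hc => h.hasDegree_cayleyCurve hπ hA hc
    · refine ((forGeneral_finite_of_not_proportional hA hπ.basepointFree hπ.concise hprop).and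
        hdist).mono fun c hc => ?_
      exact hasDegree_cayleyCurve hπ.degree_pos.ne' hA hπ.basepointFree hc.2 (hc.1 hc.2)
  · obtain ⟨w, k, N, h⟩ := hcoord (himp.exists_diffLattice_eq_span hπ)
    exact ⟨N, _, h.isReduction⟩
  · obtain ⟨w, hw, hspan, hgreatest⟩ := hred.1
    obtain ⟨k, N, h⟩ := exists_isLinearCoordinate hw hspan
    obtain rfl := h.isLatticeLength.unique hgreatest
    refine ⟨fun g hg => ?_, h.hasDegree_cayleyCurve hπ hA hf⟩
    rw [cayleyCurve, cayleyCurve, h.rhoImage_eq hπ hf, h.rhoImage_eq_of_isReduction hred hg]
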